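/- Let $R$ be an associative unital ring and let $V$ be a left $R$-module. Write $\mathrm{Gen}(V)$ for the class of modules $X$ admitting an epimorphism $V^{(I)}\twoheadrightarrow X$ for some set $I$, $\mathrm{Pres}(V)$ for the class of modules $X$ admitting an exact sequence $V^{(J)}\to V^{(I)}\to X\to 0$ for some sets $I,J$, and $\overline{\mathrm{Gen}}(V)$ for the class of modules that embed in a module of $\mathrm{Gen}(V)$. An object $V$ of an abelian category $\mathcal{A}$ with coproducts is called classical $1$-tilting if $\mathrm{Gen}(V)=\mathrm{Ker}\,\mathrm{Ext}^1_{\mathcal{A}}(V,-)$ and the canonical map $\mathrm{Hom}_{\mathcal{A}}(V,V)^{(I)}\to\mathrm{Hom}_{\mathcal{A}}(V,V^{(I)})$ is bijective for every set $I$. For a torsion pair $\mathbf{t}=(\mathcal{T},\mathcal{F})$ in a Grothendieck category $\mathcal{G}$, let $\mathcal{H}_{\mathbf{t}}(\mathcal{G})$ be the full subcategory of the derived category $\mathcal{D}(\mathcal{G})$ formed by the complexes $X$ with $H^i(X)=0$ for $i\neq -1,0$, $H^{0}(X)\in\mathcal{T}$ and $H^{-1}(X)\in\mathcal{F}$ (the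 heart of the associated Happel--Reiten--Smalø t-structure, which is an abelian category with coproducts); put $\mathcal{H}_{\mathbf{t}}=\mathcal{H}_{\mathbf{t}}(R\text{-Mod})$. A progenerator is a compact projective generator. Consider the following conditions: 1) $V$ is a classical $1$-tilting $R$-module; 2) $\mathbf{t}=(\mathrm{Pres}(V),\mathrm{Ker}\,\mathrm{Hom}_R(V,-))$ is a torsion pair in $R\text{-Mod}$ and the stalk complex $V[0]$ is a progenerator of $\mathcal{H}_{\mathbf{t}}$; 3) $V$ is finitely presented and a) $\mathcal{T}:=\mathrm{Pres}(V)=\mathrm{Gen}(V)\subseteq\mathrm{Ker}\,\mathrm{Ext}^1_R(V,-)$; b) $\mathrm{Ext}^2_R(V,-)$ vanishes on $\mathcal{F}:=\mathrm{Ker}\,\mathrm{Hom}_R(V,-)$; c) every module of $\mathcal{F}$ embeds in a module of $\mathcal{T}$. Then 1) implies 2), and 2) is equivalent to 3). Moreover, when 2) or 3) holds, $\mathcal{G}:=\overline{\mathrm{Gen}}(V)$ is a Grothendieck category, $\mathcal{T}$ and $\mathcal{F}$ are contained in $\mathcal{G}$ and $\mathbf{t}=(\mathcal{T},\mathcal{F})$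 is also a torsion pair in $\mathcal{G}$, $V$ is a classical $1$-tilting object of $\mathcal{G}$, and the canonical functor $\mathcal{D}(\mathcal{G})\to\mathcal{D}(R)$ induced by the exact inclusion $\mathcal{G}\hookrightarrow R\text{-Mod}$ restricts to an equivalence of categories $\mathcal{H}_{\mathbf{t}}(\mathcal{G})\to\mathcal{H}_{\mathbf{t}}$. -/

import Mathlib

open CategoryTheory CategoryTheory.Limits DirectSum

universe t w v u

noncomputable section

namespace TiltingHeart

section Objects

variable {C : Type u} [Category.{v} C]

section Preadditive

variable [Preadditive C]

open scoped Classical in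
/-- For a cocone `c` over a discrete family `X`, the canonical homomorphism
`⨁ i, Hom(P, X i) → Hom(P, c.pt)`. -/
def coproductComparison (P : C) {I : Type t} {X : I → C} (c : Cofan X) :
    (⨁ i, (P ⟶ X i)) →+ (P ⟶ c.pt) :=
  DirectSum.toAddMonoid fun i => Preadditive.rightComp P (c.inj i)

/-- `P` is compact: `Hom(P, -)` preserves all coproducts indexed by types in `Type t`. -/
def IsCompactObject (P : C) : Prop :=
  ∀ (I : Type t) (X : I → C) (c : Cofan X), IsColimit c →
    Function.Bijective (coproductComparison P c)

/-- `V` is self-small: `Hom(V, V)^(I) → Hom(V, V^(I))` is an isomorphism for all sets `I`. -/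
def IsSelfSmall (V : C) : Prop :=
  ∀ (I : Type v) (c : Cofan fun _ : I => V), IsColimit c →
    Function.Bijective (coproductComparison V c)

/-- `P` is a progenerator: a compact projective generator. -/
structure IsProgenerator (P : C) : Prop where
  projective : Projective P
  compact : IsCompactObject.{t} P
  generator : IsSeparator P

/-- The class `Ker Hom(V, -)`. -/
def kerHom (V : C) : ObjectProperty C := fun X => ∀ f : V ⟶ X, f = 0

end Preadditive

/-- `Gen V`: the objects `X` with an epimorphism `V^(I) ⟶ X` for some set `I`. -/
def gen (V : C) : ObjectProperty C := fun X =>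
  ∃ (I : Type v) (c : Cofan fun _ : I => V) (_ : IsColimit c) (p : c.pt ⟶ X), Epi p

/-- The `V`-subgenerated objects: those embedding in an object of `Gen V`. -/
def subgen (V : C) : ObjectProperty C := fun X =>
  ∃ (Y : C) (_ : gen V Y) (i : X ⟶ Y), Mono i

variable [Abelian C]

/-- `Pres V`: the objects `X` with an exact sequence `V^(J) ⟶ V^(I) ⟶ X ⟶ 0`
for some sets `I`, `J`. -/
def pres (V : C) : ObjectProperty C := fun X =>
  ∃ (I J : Type v) (c : Cofan fun _ : I => V) (_ : IsColimit c)
    (d : Cofan fun _ : J => V) (_ : IsColimit d)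
    (f : d.pt ⟶ c.pt) (p : c.pt ⟶ X) (h : f ≫ p = 0),
    (ShortComplex.mk f p h).Exact ∧ Epi p

/-- The class `Ker Ext^n(V, -)`. -/
def kerExt (n : ℕ) (V : C) : ObjectProperty C := fun X =>
  haveI := HasExt.standard C
  Subsingleton (Abelian.Ext.{max u v} V X n)

/-- `V` is classical 1-tilting: `Gen V = Ker Ext^1(V, -)` and `V` is self-small. -/
structure IsClassicalOneTilting (V : C) : Prop where
  gen_eq : gen V = kerExt 1 V
  selfSmall : IsSelfSmall V

/-- `(T, F)` is a torsion pair in the abelian category `C`. -/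
structure IsTorsionPair (T F : ObjectProperty C) : Prop where
  hom_eq_zero : ∀ ⦃X Y : C⦄, T X → F Y → ∀ f : X ⟶ Y, f = 0
  exists_shortExact : ∀ X : C, ∃ (A B : C) (_ : T A) (_ : F B) (i : A ⟶ X) (p : X ⟶ B)
    (h : i ≫ p = 0), (ShortComplex.mk i p h).ShortExact

section Heart

variable [HasDerivedCategory.{w} C]

/-- The aisle `{X ∈ D^{≤ 0} | H^0(X) ∈ T}`. -/
def aisle (T : ObjectProperty C) : ObjectProperty (DerivedCategory C) := fun X =>
  X.IsLE 0 ∧ T ((DerivedCategory.homologyFunctor C 0).obj X)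

/-- The co-aisle `{X ∈ D^{≥ -1} | H^{-1}(X) ∈ F}`. -/
def coaisle (F : ObjectProperty C) : ObjectProperty (DerivedCategory C) := fun X =>
  X.IsGE (-1) ∧ F ((DerivedCategory.homologyFunctor C (-1)).obj X)

/-- The heart of the Happel-Reiten-Smalø t-structure of the pair `(T, F)`. -/
def heart (T F : ObjectProperty C) : ObjectProperty (DerivedCategory C) :=
  aisle T ⊓ coaisle F

end Heart

end Objects

section Subgenerated

variable {C : Type u} [Category.{v} C]

lemma gen_of_epi {V X Y : C} (f : X ⟶ Y) [Epi f] (h : gen V X) : gen V Y := by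
  obtain ⟨I, c, hc, p, hp⟩ := h
  exact ⟨I, c, hc, p ≫ f, epi_comp _ _⟩

lemma gen_self (V : C) : gen V V := by
  refine ⟨PUnit, Cofan.mk V fun _ => 𝟙 V, ?_, 𝟙 V, (inferInstance : Epi (𝟙 V))⟩
  exact Cofan.IsColimit.mk _ (fun s => s.inj PUnit.unit) (fun s j => by simp)
    (fun s m hm => by simpa using hm PUnit.unit)

lemma subgen_self (V : C) : subgen V V := ⟨V, gen_self V, 𝟙 V, inferInstance⟩

variable [Abelian C]

lemma gen_biprod {V X Y : C} (hX : gen V X) (hY : gen V Y) : gen V (X ⊞ Y) := by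
  obtain ⟨I, c, hc, p, hp⟩ := hX
  obtain ⟨J, d, hd, q, hq⟩ := hY
  have key := Cofan.combPairIsColimit hc hd (BinaryBiproduct.isColimit c.pt d.pt)
  have e : (Sum.elim (fun _ : I => V) (fun _ : J => V)) = fun _ => V := by
    funext i; cases i <;> rfl
  have hmap : Epi (biprod.map p q) := inferInstance
  revert key
  generalize Cofan.combPairHoms c d _ = φ
  revert φ
  rw [e]
  intro φ key
  exact ⟨I ⊕ J, _, key, biprod.map p q, hmap⟩

instance (V : C) : (subgen V).IsClosedUnderSubobjects where
  prop_of_mono f _ := by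
    rintro ⟨Z, hZ, i, hi⟩
    exact ⟨Z, hZ, f ≫ i, mono_comp _ _⟩

instance (V : C) : (subgen V).IsClosedUnderQuotients where
  prop_of_epi f _ := by
    rintro ⟨Z, hZ, i, hi⟩
    exact ⟨pushout f i, gen_of_epi (pushout.inr f i) hZ, pushout.inl f i, inferInstance⟩

instance (V : C) : (subgen V).ContainsZero where
  exists_zero := by
    obtain ⟨Z, hZ⟩ := HasZeroObject.zero (C := C)
    have : Mono (0 : Z ⟶ V) := ⟨fun _ _ _ => hZ.eq_of_tgt _ _⟩
    exact ⟨Z, hZ, (subgen V).prop_of_mono (0 : Z ⟶ V) (subgen_self V)⟩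

instance (V : C) : (subgen V).IsClosedUnderBinaryProducts where
  limitsOfShape_le := by
    rintro X ⟨p⟩
    obtain ⟨Y₁, h₁, i₁, _⟩ := p.prop_diag_obj ⟨WalkingPair.left⟩
    obtain ⟨Y₂, h₂, i₂, _⟩ := p.prop_diag_obj ⟨WalkingPair.right⟩
    refine ⟨Y₁ ⊞ Y₂, gen_biprod h₁ h₂,
      biprod.lift (p.π.app ⟨WalkingPair.left⟩ ≫ i₁) (p.π.app ⟨WalkingPair.right⟩ ≫ i₂), ?_⟩
    refine Preadditive.mono_of_cancel_zero _ fun g hg => ?_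
    have e₁ := hg =≫ biprod.fst
    have e₂ := hg =≫ biprod.snd
    simp only [Category.assoc, biprod.lift_fst, biprod.lift_snd, zero_comp] at e₁ e₂
    rw [← Category.assoc] at e₁ e₂
    refine p.isLimit.hom_ext ?_
    rintro ⟨_ | _⟩
    · simpa using (cancel_mono i₁).1 (e₁.trans zero_comp.symm)
    · simpa using (cancel_mono i₂).1 (e₂.trans zero_comp.symm)

instance (V : C) : (subgen V).IsClosedUnderFiniteProducts :=
  ObjectProperty.IsClosedUnderFiniteProducts.mk'

/-- The full subcategory of `V`-subgenerated objects; it is abelian. -/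
abbrev Subgen (V : C) := (subgen V).FullSubcategory

/-- `V` as an object of the category of `V`-subgenerated objects. -/
abbrev Subgen.self (V : C) : Subgen V := ⟨V, subgen_self V⟩

/-- The inclusion of the category of `V`-subgenerated objects. -/
abbrev Subgen.incl (V : C) : Subgen V ⥤ C := (subgen V).ι

instance (V : C) : PreservesFiniteLimits (Subgen.incl V) :=
  have := (subgen V).preservesKernels_ι
  Functor.preservesFiniteLimits_of_preservesKernels _

instance (V : C) : PreservesFiniteColimits (Subgen.incl V) :=
  have := (subgen V).preservesCokernels_ι
  Functor.preservesFiniteColimits_of_preservesCokernels _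

end Subgenerated

section Conditions

variable {R : Type u} [Ring R] (V : ModuleCat.{u} R)

/-- `(Pres V, Ker Hom(V, -))` is a torsion pair and the stalk complex `V[0]` is a progenerator
of its heart. -/
def StalkIsProgenerator [HasDerivedCategory.{w} (ModuleCat.{u} R)] : Prop :=
  IsTorsionPair (pres V) (kerHom V) ∧
    ∃ h : heart (pres V) (kerHom V) ((DerivedCategory.singleFunctor (ModuleCat.{u} R) 0).obj V),
      IsProgenerator.{u}
        (⟨_, h⟩ : (heart (pres V) (kerHom V)).FullSubcategory)

/-- `V` is finitely presented, `Pres V = Gen V ⊆ Ker Ext^1(V, -)`, `Ext^2(V, -)` vanishes on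
`Ker Hom(V, -)`, and every module of `Ker Hom(V, -)` embeds in a module of `Pres V`. -/
structure IsStalkProgeneratorModule : Prop where
  finitePresentation : Module.FinitePresentation R V
  pres_eq_gen : pres V = gen V
  gen_le_kerExt_one : gen V ≤ kerExt 1 V
  kerHom_le_kerExt_two : kerHom V ≤ kerExt 2 V
  embeds : ∀ F : ModuleCat.{u} R, kerHom V F →
    ∃ (T : ModuleCat.{u} R) (_ : pres V T) (i : F ⟶ T), Mono i

/-- The torsion class `Pres V`, regarded inside the category of `V`-subgenerated modules. -/
abbrev torsionIn : ObjectProperty (Subgen V) := (pres V).inverseImage (Subgen.incl V)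

/-- The class `Ker Hom(V, -)`, regarded inside the category of `V`-subgenerated modules. -/
abbrev torsionFreeIn : ObjectProperty (Subgen V) := (kerHom V).inverseImage (Subgen.incl V)

end Conditions

end TiltingHeart

end

noncomputable section

namespace TiltingHeart

open DerivedCategory Pretriangulated

/-! ### Morphisms from stalk complexes to bounded below objects -/

section Resolution
variable {C : Type u} [Category.{v} C] [Abelian C] [HasDerivedCategory.{w} C]

/-! Write `T = Gen V` and `F = Ker Hom(V, -)`. A morphism in the heart is epi exactly when its cone
`Z` lies in the shifted aisle. Since `H^{-2}(Z)` embeds in `H^{-1}` of the source, such a `Z` is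
built from a module of `T` in degree `-1` and one of `F` in degree `-2`. Lifting a map out of `V[0]`
is therefore governed by `Ext^1(V, T)` and `Ext^2(V, F)`, and their vanishing makes `V[0]`
projective. It generates because `Pres V = Gen V` covers `T` by copies of `V` with kernel in `T`,
while an embedding `B → A` of `B` in `F` into `A` in `T` makes `(A/B)[0] → B[1]` epi. Compactness
then follows from self-smallness. This is `IsTiltingTorsionPair.isProgenerator`; it serves 1) and 3)
at once, since both yield `IsWeakTilting`.

Conversely, a map `P → A[1]` classifies an extension inside the heart, so projectivity gives both
Ext conditions, and an epi `V^(I)[0] → A[1]` embeds `A` in `H^{-1}` of its cone, a torsion module.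
The hard point is finite presentation. A directed system with zero colimit gives a surjection from
the sum of `M i` over `i ≤ j` to the sum of all `M i`. When `Ext(V, -)` of its kernel vanishes in
the right degree, maps or extension classes of `V` lift along it, and compactness kills them at a
finite stage. Applied to the quotients of `V` by finitely generated submodules this makes `V`
finitely generated. For the kernel `K` of `R^n → V` it is applied to torsion-free quotients of `K`,
and a final use of `Ext^1` makes `K` finitely generated.

For the last claims, `subgen V` is closed under subobjects, quotients and coproducts, hence
Grothendieck. That `V` is tilting there rests on `gen_of_mono`: a submodule `X` of `Y` in `Gen V` is
again in `Gen V` if all maps `V → Y/X` lift. The functor between hearts is bijective on maps out of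
`V[0]`, then out of `V^(I)[0]`, then out of all objects by presenting them as cones of `M → V^(I)`.
It is dense because the same cones can be formed in the smaller category. -/

lemma Q_map_surjective_of_isKInjective (K L : CochainComplex C ℤ) [L.IsKInjective]
    (f : Q.obj K ⟶ Q.obj L) : ∃ φ : K ⟶ L, Q.map φ = f := by
  obtain ⟨ψ, hψ⟩ := (CochainComplex.IsKInjective.Qh_map_bijective
    ((HomotopyCategory.quotient _ _).obj K) L).2
      ((quotientCompQhIso C).hom.app K ≫ f ≫ (quotientCompQhIso C).inv.app L)
  obtain ⟨φ, rfl⟩ := (HomotopyCategory.quotient _ _).map_surjective ψ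
  refine ⟨φ, ?_⟩
  have := (quotientCompQhIso C).hom.naturality φ
  rw [← cancel_epi ((quotientCompQhIso C).hom.app K), ← this]
  dsimp
  rw [hψ]
  simp

lemma homotopy_zero_of_isKInjective {K L : CochainComplex C ℤ} [L.IsKInjective]
    (φ : K ⟶ L) (h : Q.map φ = 0) : Nonempty (Homotopy φ 0) := by
  refine ⟨HomotopyCategory.homotopyOfEq _ _ ?_⟩
  apply (CochainComplex.IsKInjective.Qh_map_bijective _ L).1
  rw [← cancel_mono ((quotientCompQhIso C).hom.app L)]
  simp [h]

/-- The stalk object in degree zero, computed on the level of complexes. -/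
def stalkIso (A : C) :
    (singleFunctor C 0).obj A ≅ Q.obj ((HomologicalComplex.single C (.up ℤ) 0).obj A) :=
  (singleFunctorIsoCompQ C 0).app A

lemma stalkIso_hom_naturality {A B : C} (a : A ⟶ B) :
    (singleFunctor C 0).map a ≫ (stalkIso B).hom =
      (stalkIso A).hom ≫ Q.map ((HomologicalComplex.single C (.up ℤ) 0).map a) :=
  (singleFunctorIsoCompQ C 0).hom.naturality a

/-- Morphisms from stalk complexes to a bounded below object are computed by an injective
resolution. -/
lemma exists_stalk_presentation [EnoughInjectives C] (Y : DerivedCategory C) (n : ℤ) [Y.IsGE n] :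
    ∃ (B Z : C) (d : B ⟶ Z) (q : (singleFunctor C 0).obj Z ⟶ Y),
      (∀ (A : C) (f : (singleFunctor C 0).obj A ⟶ Y), ∃ a : A ⟶ Z,
        f = (singleFunctor C 0).map a ≫ q) ∧
      (singleFunctor C 0).map d ≫ q = 0 ∧
      ∀ (A : C) (a : A ⟶ Z), (singleFunctor C 0).map a ≫ q = 0 → ∃ b : A ⟶ B, a = b ≫ d := by
  obtain ⟨K, _, ⟨e⟩⟩ := DerivedCategory.exists_iso_Q_obj_of_isGE Y n
  obtain ⟨L, i, _, _, _⟩ := CochainComplex.Plus.modelCategoryQuillen.exists_quasiIso_injective K n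
  have := CochainComplex.isKInjective_of_injective L n
  let e' : Q.obj L ≅ Y := (asIso (Q.map i)).symm ≪≫ e.symm
  let ψ : (HomologicalComplex.single C (.up ℤ) 0).obj (L.cycles 0) ⟶ L :=
    HomologicalComplex.mkHomFromSingle (L.iCycles 0) (fun k _ => by simp)
  have key : ∀ (A : C) (a : A ⟶ L.cycles 0),
      (singleFunctor C 0).map a ≫ (stalkIso _).hom ≫ Q.map ψ ≫ e'.hom =
      (stalkIso A).hom ≫ Q.map ((HomologicalComplex.single C (.up ℤ) 0).map a ≫ ψ) ≫ e'.hom := by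
    intro A a
    rw [← Category.assoc, stalkIso_hom_naturality, Q.map_comp, Category.assoc, Category.assoc]
  have key0 : ∀ (A : C) (a : A ⟶ L.cycles 0),
      ((HomologicalComplex.single C (.up ℤ) 0).map a ≫ ψ).f 0 =
      (HomologicalComplex.singleObjXSelf (.up ℤ) 0 A).hom ≫ a ≫ L.iCycles 0 := by
    intro A a
    simp [ψ, HomologicalComplex.single_map_f_self]
  refine ⟨L.X (-1), L.cycles 0, L.toCycles (-1) 0, (stalkIso _).hom ≫ Q.map ψ ≫ e'.hom,
    ?_, ?_, ?_⟩
  · intro A f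
    obtain ⟨φ, hφ⟩ := Q_map_surjective_of_isKInjective
      ((HomologicalComplex.single C (.up ℤ) 0).obj A) L ((stalkIso A).inv ≫ f ≫ e'.inv)
    have hφ0 : ((HomologicalComplex.singleObjXSelf (.up ℤ) 0 A).inv ≫ φ.f 0) ≫ L.d 0 1 = 0 := by
      rw [Category.assoc, φ.comm 0 1, HomologicalComplex.single_obj_d, zero_comp, comp_zero]
    refine ⟨L.liftCycles ((HomologicalComplex.singleObjXSelf (.up ℤ) 0 A).inv ≫ φ.f 0) 1
      (by simp) hφ0, ?_⟩
    rw [key]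
    have : (HomologicalComplex.single C (.up ℤ) 0).map (L.liftCycles
        ((HomologicalComplex.singleObjXSelf (.up ℤ) 0 A).inv ≫ φ.f 0) 1 (by simp) hφ0) ≫ ψ = φ := by
      apply HomologicalComplex.from_single_hom_ext
      rw [key0]
      simp
    rw [this, hφ, Category.assoc, Category.assoc, Iso.inv_hom_id, Category.comp_id,
      Iso.hom_inv_id_assoc]
  · rw [key]
    -- The identity of `L^{-1}`, read as a map from degree 0 to degree -1, is a null-homotopy,
    -- because `L.toCycles (-1) 0` followed by the inclusion of cycles is the differential.
    have h0 : Homotopy ((HomologicalComplex.single C (.up ℤ) 0).map (L.toCycles (-1) 0) ≫ ψ) 0 :=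
      { hom := fun i j => if h : i = 0 ∧ j = -1 then
          (HomologicalComplex.singleObjXIsoOfEq (.up ℤ) 0 (L.X (-1)) i h.1).hom ≫
            (L.XIsoOfEq h.2).inv else 0
        zero := fun i j hij => dif_neg (by rintro ⟨rfl, rfl⟩; simp at hij)
        comm := fun i => by
          by_cases hi : i = 0
          · subst hi
            rw [key0, dNext_eq _ (show (ComplexShape.up ℤ).Rel 0 1 by simp),
              prevD_eq _ (show (ComplexShape.up ℤ).Rel (-1) 0 by simp)]
            simp
            rfl
          · exact (HomologicalComplex.isZero_single_obj_X _ _ _ _ hi).eq_of_src _ _ }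
    have h1 : Q.map ((HomologicalComplex.single C (.up ℤ) 0).map (L.toCycles (-1) 0) ≫ ψ) = 0 := by
      have := HomotopyCategory.eq_of_homotopy _ _ h0
      rw [← cancel_epi ((quotientCompQhIso C).hom.app _), ← quotientCompQhIso_hom_naturality, this,
        Functor.map_zero, Functor.map_zero, zero_comp, comp_zero]
    rw [h1, zero_comp, comp_zero]
  · intro A a ha
    rw [key] at ha
    have ha' : Q.map ((HomologicalComplex.single C (.up ℤ) 0).map a ≫ ψ) = 0 := by
      rw [← cancel_mono e'.hom, ← cancel_epi ((stalkIso A).hom), ha, zero_comp, comp_zero]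
    obtain ⟨h⟩ := homotopy_zero_of_isKInjective _ ha'
    have h0 := h.comm 0
    refine ⟨(HomologicalComplex.singleObjXSelf (.up ℤ) 0 A).inv ≫ h.hom 0 (-1), ?_⟩
    rw [key0] at h0
    rw [← cancel_mono (L.iCycles 0),
      ← cancel_epi (HomologicalComplex.singleObjXSelf (.up ℤ) 0 A).hom, h0]
    rw [dNext_eq _ (show (ComplexShape.up ℤ).Rel 0 1 by simp),
      prevD_eq _ (show (ComplexShape.up ℤ).Rel (-1) 0 by simp)]
    simp

variable [EnoughInjectives C]

/-- Needed to form coproducts of copies of `V` indexed by all morphisms `V[0] ⟶ Y`, whose type lives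
in the universe of the derived category. -/
lemma small_hom_stalk (A : C) (Y : DerivedCategory C) (n : ℤ) [Y.IsGE n] :
    Small.{v} ((singleFunctor C 0).obj A ⟶ Y) := by
  obtain ⟨B, Z, d, q, h₁, -, -⟩ := exists_stalk_presentation Y n
  exact small_of_surjective (f := fun a : A ⟶ Z => (singleFunctor C 0).map a ≫ q)
    fun f => (h₁ A f).imp fun _ h => h.symm

variable {I : Type t} {A : I → C} {c : Cofan A} (hc : IsColimit c)

include hc

/-- Together with `exists_stalk_coproduct_desc`, this makes the stalk of a coproduct a coproduct as
far as bounded below targets can see. Exactness of coproducts plays no role: cycles and boundaries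
of an injective resolution are given by maps in `C`, which assemble over the summands. -/
lemma stalk_coproduct_hom_ext {Y : DerivedCategory C} (n : ℤ) [Y.IsGE n]
    {f g : (singleFunctor C 0).obj c.pt ⟶ Y}
    (h : ∀ i, (singleFunctor C 0).map (c.inj i) ≫ f = (singleFunctor C 0).map (c.inj i) ≫ g) :
    f = g := by
  obtain ⟨B, Z, d, q, h₁, h₂, h₃⟩ := exists_stalk_presentation Y n
  obtain ⟨a, rfl⟩ := h₁ _ f
  obtain ⟨b, rfl⟩ := h₁ _ g
  have h' : ∀ i, ∃ r, c.inj i ≫ (a - b) = r ≫ d := fun i => h₃ _ _ (by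
    have := h i
    rw [← Category.assoc, ← Category.assoc, ← Functor.map_comp, ← Functor.map_comp] at this
    rw [Preadditive.comp_sub, Functor.map_sub, Preadditive.sub_comp, this, sub_self])
  choose r hr using h'
  have : a - b = Cofan.IsColimit.desc hc r ≫ d :=
    Cofan.IsColimit.hom_ext hc _ _ fun i => by simp [hr]
  rw [← sub_eq_zero, ← Preadditive.sub_comp, ← Functor.map_sub, this, Functor.map_comp,
    Category.assoc, h₂, comp_zero]

lemma exists_stalk_coproduct_desc {Y : DerivedCategory C} (n : ℤ) [Y.IsGE n]
    (f : ∀ i, (singleFunctor C 0).obj (A i) ⟶ Y) :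
    ∃ g : (singleFunctor C 0).obj c.pt ⟶ Y, ∀ i, (singleFunctor C 0).map (c.inj i) ≫ g = f i := by
  obtain ⟨B, Z, d, q, h₁, h₂, h₃⟩ := exists_stalk_presentation Y n
  choose a ha using fun i => h₁ _ (f i)
  refine ⟨(singleFunctor C 0).map (Cofan.IsColimit.desc hc a) ≫ q, fun i => ?_⟩
  rw [ha i, ← Category.assoc, ← Functor.map_comp]
  simp

end Resolution

/-! ### Closure properties of torsion pairs -/

section TorsionPair

variable {C : Type u} [Category.{v} C] [Abelian C] {T F : ObjectProperty C}

namespace IsTorsionPair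

variable (h : IsTorsionPair T F)
include h

/-- The map onto the torsion-free quotient vanishes, so the torsion part is everything. All closure
properties of `T` follow from this, and those of `F` from the dual. -/
lemma torsion_of_hom_eq_zero [T.IsClosedUnderIsomorphisms] {X : C}
    (hX : ∀ Y, F Y → ∀ f : X ⟶ Y, f = 0) : T X := by
  obtain ⟨A, B, hA, hB, i, p, w, hS⟩ := h.exists_shortExact X
  have := hS.mono_f
  have : IsIso i := by
    have : Epi i := hS.exact.epi_f (hX B hB p)
    exact isIso_of_mono_of_epi i
  exact T.prop_of_iso (asIso i) hA

lemma torsionFree_of_hom_eq_zero [F.IsClosedUnderIsomorphisms] {Y : C}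
    (hY : ∀ X, T X → ∀ f : X ⟶ Y, f = 0) : F Y := by
  obtain ⟨A, B, hA, hB, i, p, w, hS⟩ := h.exists_shortExact Y
  have := hS.epi_g
  have : IsIso p := by
    have : Mono p := hS.exact.mono_g (hY A hA i)
    exact isIso_of_mono_of_epi p
  exact F.prop_of_iso (asIso p).symm hB

lemma torsion_of_epi [T.IsClosedUnderIsomorphisms] {X Y : C} (f : X ⟶ Y) [Epi f] (hX : T X) :
    T Y :=
  h.torsion_of_hom_eq_zero fun Z hZ g => by
    rw [← cancel_epi f, comp_zero]
    exact h.hom_eq_zero hX hZ _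

lemma torsionFree_of_mono [F.IsClosedUnderIsomorphisms] {X Y : C} (f : X ⟶ Y) [Mono f]
    (hY : F Y) : F X :=
  h.torsionFree_of_hom_eq_zero fun Z hZ g => by
    rw [← cancel_mono f, zero_comp]
    exact h.hom_eq_zero hZ hY _

lemma torsion_of_exact [T.IsClosedUnderIsomorphisms] {S : ShortComplex C} (hS : S.Exact)
    (hg : Epi S.g) (h₁ : T S.X₁) (h₃ : T S.X₃) : T S.X₂ :=
  h.torsion_of_hom_eq_zero fun Z hZ f => by
    obtain ⟨g, rfl⟩ := hS.desc' f (h.hom_eq_zero h₁ hZ _)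
    rw [h.hom_eq_zero h₃ hZ g, comp_zero]

lemma torsionFree_of_exact [F.IsClosedUnderIsomorphisms] {S : ShortComplex C} (hS : S.Exact)
    (hf : Mono S.f) (h₁ : F S.X₁) (h₃ : F S.X₃) : F S.X₂ :=
  h.torsionFree_of_hom_eq_zero fun Z hZ f => by
    obtain ⟨g, rfl⟩ := hS.lift' f (h.hom_eq_zero hZ h₃ _)
    rw [h.hom_eq_zero hZ h₁ g, zero_comp]

lemma torsion_of_isZero [T.IsClosedUnderIsomorphisms] {X : C} (hX : IsZero X) : T X :=
  h.torsion_of_hom_eq_zero fun _ _ _ => hX.eq_of_src _ _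

lemma torsionFree_of_isZero [F.IsClosedUnderIsomorphisms] {X : C} (hX : IsZero X) : F X :=
  h.torsionFree_of_hom_eq_zero fun _ _ _ => hX.eq_of_tgt _ _

end IsTorsionPair

end TorsionPair

/-! ### Replacing the vertices of a distinguished triangle -/

section TriangleIso

variable {D : Type*} [Category* D] [HasZeroObject D] [HasShift D ℤ] [Preadditive D]
  [∀ n : ℤ, (shiftFunctor D n).Additive] [Pretriangulated D]

lemma distinguished_of_iso {X Y Z X' Y' Z' : D} {f : X ⟶ Y} {g : Y ⟶ Z} {δ : Z ⟶ X⟦(1 : ℤ)⟧}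
    (hT : Triangle.mk f g δ ∈ distTriang D) (e₁ : X' ≅ X) (e₂ : Y' ≅ Y) (e₃ : Z' ≅ Z)
    {f' : X' ⟶ Y'} {g' : Y' ⟶ Z'} (hf : f' = e₁.hom ≫ f ≫ e₂.inv)
    (hg : g' = e₂.hom ≫ g ≫ e₃.inv) :
    Triangle.mk f' g' (e₃.hom ≫ δ ≫ e₁.inv⟦(1 : ℤ)⟧') ∈ distTriang D := by
  have h₁ : f' ≫ e₂.hom = e₁.hom ≫ f := by simp [hf]
  have h₂ : g' ≫ e₃.hom = e₂.hom ≫ g := by simp [hg]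
  have h₃ : (e₃.hom ≫ δ ≫ e₁.inv⟦(1 : ℤ)⟧') ≫ e₁.hom⟦(1 : ℤ)⟧' = e₃.hom ≫ δ := by
    simp [← Functor.map_comp]
  exact isomorphic_distinguished _ hT _ (Triangle.isoMk _ _ e₁ e₂ e₃ h₁ h₂ h₃)

end TriangleIso

/-! ### Long exact homology sequences and truncation triangles -/

section Truncation

variable {C : Type u} [Category.{v} C] [Abelian C] [HasDerivedCategory.{w} C]

/-- The homology of a stalk complex in its degree. -/
def homologyStalkIso (n : ℤ) (A : C) :
    (homologyFunctor C n).obj ((singleFunctor C n).obj A) ≅ A :=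
  (singleFunctorCompHomologyFunctorIso C n).app A

/-- The homology of a shifted object. -/
def homologyShiftIso (X : DerivedCategory C) (a n m : ℤ) (h : a + n = m) :
    (homologyFunctor C n).obj (X⟦a⟧) ≅ (homologyFunctor C m).obj X :=
  ((homologyFunctor C 0).shiftIso a n m h).app X

section Triangle

variable {X Y Z : DerivedCategory C} {f : X ⟶ Y} {g : Y ⟶ Z} {δ : Z ⟶ X⟦(1 : ℤ)⟧}
  (hT : Triangle.mk f g δ ∈ distTriang _)
include hT

lemma exact_homology₂ (n : ℤ) :
    ∃ w, (ShortComplex.mk ((homologyFunctor C n).map f) ((homologyFunctor C n).map g) w).Exact :=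
  ⟨_, HomologySequence.exact₂ _ hT n⟩

lemma mono_homology_map₂ (n : ℤ) (hX : IsZero ((homologyFunctor C n).obj X)) :
    Mono ((homologyFunctor C n).map g) :=
  (HomologySequence.exact₂ _ hT n).mono_g (hX.eq_of_src _ _)

lemma epi_homology_map₂ (n m : ℤ) (hnm : n + 1 = m) (hX : IsZero ((homologyFunctor C m).obj X)) :
    Epi ((homologyFunctor C n).map g) :=
  (HomologySequence.exact₃ _ hT n m hnm).epi_f (hX.eq_of_tgt _ _)

lemma mono_homology_map₁ (n m : ℤ) (hnm : n + 1 = m) (hZ : IsZero ((homologyFunctor C n).obj Z)) :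
    Mono ((homologyFunctor C m).map f) :=
  (HomologySequence.exact₁ _ hT n m hnm).mono_g (hZ.eq_of_src _ _)

lemma epi_homology_map₁ (n : ℤ) (hZ : IsZero ((homologyFunctor C n).obj Z)) :
    Epi ((homologyFunctor C n).map f) :=
  (HomologySequence.exact₂ _ hT n).epi_f (hZ.eq_of_tgt _ _)

lemma exists_mono_homology₃ (n m : ℤ) (hnm : n + 1 = m)
    (hY : IsZero ((homologyFunctor C n).obj Y)) :
    ∃ (d : (homologyFunctor C n).obj Z ⟶ (homologyFunctor C m).obj X)
      (w : d ≫ (homologyFunctor C m).map f = 0), Mono d ∧ (ShortComplex.mk _ _ w).Exact :=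
  ⟨_, _, (HomologySequence.exact₃ _ hT n m hnm).mono_g (hY.eq_of_src _ _),
    HomologySequence.exact₁ _ hT n m hnm⟩

lemma isLE_of_triangle₃ (n m : ℤ) (hnm : n + 1 = m) [hX : X.IsLE m] [hY : Y.IsLE n] :
    Z.IsLE n := by
  rw [isLE_iff] at hX hY ⊢
  intro i hi
  exact (HomologySequence.exact₃ _ hT i (i + 1) rfl).isZero_of_both_isZero (hY i hi)
    (hX (i + 1) (by lia))

lemma isGE_of_triangle₃ (n m : ℤ) (hnm : n + 1 = m) [hX : X.IsGE m] [hY : Y.IsGE n] :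
    Z.IsGE n := by
  rw [isGE_iff] at hX hY ⊢
  intro i hi
  exact (HomologySequence.exact₃ _ hT i (i + 1) rfl).isZero_of_both_isZero (hY i hi)
    (hX (i + 1) (by lia))

lemma isGE_of_triangle₁ (n m : ℤ) (hnm : n + 1 = m) [hY : Y.IsGE m] [hZ : Z.IsGE n] :
    X.IsGE m := by
  rw [isGE_iff] at hY hZ ⊢
  intro i hi
  exact (HomologySequence.exact₁ _ hT (i - 1) i (by simp)).isZero_of_both_isZero
    (hZ _ (by lia)) (hY i hi)

lemma isLE_of_triangle₂ (n : ℤ) [hX : X.IsLE n] [hZ : Z.IsLE n] : Y.IsLE n := by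
  rw [isLE_iff] at hX hZ ⊢
  intro i hi
  exact (HomologySequence.exact₂ _ hT i).isZero_of_both_isZero (hX i hi) (hZ i hi)

lemma isGE_of_triangle₂ (n : ℤ) [hX : X.IsGE n] [hZ : Z.IsGE n] : Y.IsGE n := by
  rw [isGE_iff] at hX hZ ⊢
  intro i hi
  exact (HomologySequence.exact₂ _ hT i).isZero_of_both_isZero (hX i hi) (hZ i hi)

lemma exists_desc_of_triangle {W : DerivedCategory C} (k : Y ⟶ W) (hk : f ≫ k = 0) :
    ∃ l : Z ⟶ W, k = g ≫ l :=
  Triangle.yoneda_exact₂ _ hT k hk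

lemma exists_desc_of_triangle₃ {W : DerivedCategory C} (k : Z ⟶ W) (hk : g ≫ k = 0) :
    ∃ l : X⟦(1 : ℤ)⟧ ⟶ W, k = δ ≫ l :=
  Triangle.yoneda_exact₃ _ hT k hk

lemma exists_lift_of_triangle {W : DerivedCategory C} (k : W ⟶ Y) (hk : k ≫ g = 0) :
    ∃ l : W ⟶ X, k = l ≫ f :=
  Triangle.coyoneda_exact₂ _ hT k hk

lemma exists_lift_of_triangle₃ {W : DerivedCategory C} (k : W ⟶ Z) (hk : k ≫ δ = 0) :
    ∃ l : W ⟶ Y, k = l ≫ g :=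
  Triangle.coyoneda_exact₃ _ hT k hk

lemma triangle_comp₁₂ : f ≫ g = 0 := comp_distTriang_mor_zero₁₂ _ hT
lemma triangle_comp₂₃ : g ≫ δ = 0 := comp_distTriang_mor_zero₂₃ _ hT

end Triangle

/-- Splits off the top homology as a stalk, so that statements about the aisle reduce to statements
about objects of `C`. -/
lemma exists_stalk_truncation_le (X : DerivedCategory C) (n m : ℤ) (hnm : m + 1 = n) [X.IsLE n] :
    ∃ (X' : DerivedCategory C) (M : C) (i : X' ⟶ X) (p : X ⟶ (singleFunctor C n).obj M)
      (δ : (singleFunctor C n).obj M ⟶ X'⟦(1 : ℤ)⟧), Triangle.mk i p δ ∈ distTriang _ ∧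
      X'.IsLE m ∧ IsIso ((homologyFunctor C n).map p) := by
  obtain ⟨X', Y, hX', hY, i, p, δ, hT⟩ := TStructure.t.exists_triangle X m n hnm
  have : X'.IsLE m := ⟨hX'⟩
  have : Y.IsGE n := ⟨hY⟩
  have : X'.IsLE (n + 1) := TStructure.t.isLE_of_le _ m _ (by lia)
  have : Y.IsLE n := isLE_of_triangle₃ hT n _ rfl
  obtain ⟨M, ⟨e⟩⟩ := exists_iso_singleFunctor_obj_of_isGE_of_isLE Y n
  have hT' := distinguished_of_iso hT (Iso.refl _) (Iso.refl _) e.symm (f' := i)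
    (g' := p ≫ e.hom) (by simp) (by simp)
  refine ⟨X', M, i, _, _, hT', inferInstance, ?_⟩
  have := mono_homology_map₂ hT' n (isZero_of_isLE X' m n (by lia))
  have := epi_homology_map₂ hT' n _ rfl (isZero_of_isLE X' m (n + 1) (by lia))
  exact isIso_of_mono_of_epi _

lemma exists_stalk_truncation_ge (Y : DerivedCategory C) (n m : ℤ) (hnm : n + 1 = m) [Y.IsGE n] :
    ∃ (Y' : DerivedCategory C) (M : C) (i : (singleFunctor C n).obj M ⟶ Y) (p : Y ⟶ Y')
      (δ : Y' ⟶ ((singleFunctor C n).obj M)⟦(1 : ℤ)⟧), Triangle.mk i p δ ∈ distTriang _ ∧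
      Y'.IsGE m ∧ IsIso ((homologyFunctor C n).map i) := by
  obtain ⟨X, Y', hX, hY', i, p, δ, hT⟩ := TStructure.t.exists_triangle Y n m hnm
  have : X.IsLE n := ⟨hX⟩
  have : Y'.IsGE m := ⟨hY'⟩
  have : Y'.IsGE (n - 1) := TStructure.t.isGE_of_ge _ _ m (by lia)
  have : X.IsGE n := isGE_of_triangle₁ hT (n - 1) n (by simp)
  obtain ⟨M, ⟨e⟩⟩ := exists_iso_singleFunctor_obj_of_isGE_of_isLE X n
  have hT' := distinguished_of_iso hT e.symm (Iso.refl _) (Iso.refl _) (f' := e.inv ≫ i)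
    (g' := p) (by simp) (by simp)
  refine ⟨Y', M, _, p, _, hT', inferInstance, ?_⟩
  have := mono_homology_map₁ hT' (n - 1) n (by simp) (isZero_of_isGE Y' m (n - 1) (by lia))
  have := epi_homology_map₁ hT' n (isZero_of_isGE Y' m n (by lia))
  exact isIso_of_mono_of_epi _

end Truncation

/-! ### The heart: orthogonality, extensions and epimorphisms -/

section HeartLemmas

variable {C : Type u} [Category.{v} C] [Abelian C] [HasDerivedCategory.{w} C]

/-- The stalk complex of `A` in degree `-(n + 1)` is the shift of the one in degree `-n`. -/
def stalkShiftIso (n m : ℤ) (h : 1 + m = n) (A : C) :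
    ((singleFunctor C n).obj A)⟦(1 : ℤ)⟧ ≅ (singleFunctor C m).obj A :=
  ((singleFunctors C).shiftIso 1 m n h).app A

lemma isZero_homology_stalk (n m : ℤ) (h : m ≠ n) (A : C) :
    IsZero ((homologyFunctor C m).obj ((singleFunctor C n).obj A)) := by
  rcases lt_or_gt_of_ne h with h | h
  · exact isZero_of_isGE _ n m h
  · exact isZero_of_isLE _ n m h

/-- The shifted aisle `{X ∈ D^{≤ -1} | H^{-1}(X) ∈ T}`. -/
def shiftedAisle (T : ObjectProperty C) : ObjectProperty (DerivedCategory C) := fun X =>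
  X.IsLE (-1) ∧ T ((homologyFunctor C (-1)).obj X)

variable {T F : ObjectProperty C} [T.IsClosedUnderIsomorphisms] [F.IsClosedUnderIsomorphisms]

lemma shiftedAisle_shift {X : DerivedCategory C} (hX : aisle T X) :
    shiftedAisle T (X⟦(1 : ℤ)⟧) := by
  have := hX.1
  exact ⟨TStructure.t.isLE_shift X 0 1 (-1), T.prop_of_iso
    (homologyShiftIso X 1 (-1) 0 (by simp)).symm hX.2⟩

lemma aisle_stalk {A : C} (hA : T A) : aisle T ((singleFunctor C 0).obj A) :=
  ⟨inferInstance, T.prop_of_iso (homologyStalkIso 0 A).symm hA⟩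

instance : (aisle T : ObjectProperty (DerivedCategory C)).IsClosedUnderIsomorphisms where
  of_iso {X Y} e hX := by
    have := hX.1
    exact ⟨TStructure.t.isLE_of_iso e 0, T.prop_of_iso ((homologyFunctor C 0).mapIso e) hX.2⟩

instance : (coaisle F : ObjectProperty (DerivedCategory C)).IsClosedUnderIsomorphisms where
  of_iso {X Y} e hX := by
    have := hX.1
    exact ⟨TStructure.t.isGE_of_iso e (-1), F.prop_of_iso ((homologyFunctor C (-1)).mapIso e) hX.2⟩

instance : (heart T F : ObjectProperty (DerivedCategory C)).IsClosedUnderIsomorphisms where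
  of_iso e hX := ⟨(aisle T).prop_of_iso e hX.1, (coaisle F).prop_of_iso e hX.2⟩

namespace IsTorsionPair

variable (h : IsTorsionPair T F)
include h

/-- For degree reasons the map factors through the top homology of `X` and the bottom homology of
`Y`, both in degree `-1`, where it becomes a map from `T` to `F`. -/
lemma hom_eq_zero_of_shiftedAisle {X Y : DerivedCategory C} (hX : shiftedAisle T X)
    (hY : coaisle F Y) (f : X ⟶ Y) : f = 0 := by
  obtain ⟨_, hX⟩ := hX
  obtain ⟨_, hY⟩ := hY
  obtain ⟨X', M, i, p, δ, hT, _, _⟩ := exists_stalk_truncation_le X (-1) (-2) (by simp)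
  obtain ⟨Y', N, j, q, ε, hT', _, _⟩ := exists_stalk_truncation_ge Y (-1) 0 (by simp)
  have hM : T M := T.prop_of_iso
    (asIso ((homologyFunctor C (-1)).map p) ≪≫ homologyStalkIso (-1) M) hX
  have hN : F N := F.prop_of_iso
    ((asIso ((homologyFunctor C (-1)).map j)).symm ≪≫ homologyStalkIso (-1) N) hY
  obtain ⟨g, rfl⟩ := exists_desc_of_triangle hT f (TStructure.t.zero _ (-2) (-1))
  obtain ⟨k, rfl⟩ := exists_lift_of_triangle hT' g (TStructure.t.zero _ (-1) 0)
  obtain ⟨k, rfl⟩ := (singleFunctor C (-1)).map_surjective k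
  rw [h.hom_eq_zero hM hN k]
  simp

lemma heart_stalk {A : C} (hA : T A) : heart T F ((singleFunctor C 0).obj A) :=
  ⟨aisle_stalk hA, TStructure.t.isGE_of_ge _ (-1) 0,
    h.torsionFree_of_isZero (isZero_homology_stalk _ _ (by simp) _)⟩

lemma heart_stalk_shift {B : C} (hB : F B) : heart T F ((singleFunctor C (-1)).obj B) :=
  ⟨⟨TStructure.t.isLE_of_le _ (-1) 0,
    h.torsion_of_isZero (isZero_homology_stalk _ _ (by simp) _)⟩, inferInstance,
    F.prop_of_iso (homologyStalkIso (-1) B).symm hB⟩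

variable {X Y Z : DerivedCategory C} {f : X ⟶ Y} {g : Y ⟶ Z} {δ : Z ⟶ X⟦(1 : ℤ)⟧}
  (hT : Triangle.mk f g δ ∈ distTriang _)

include hT

lemma heart_of_triangle₂ (hX : heart T F X) (hZ : heart T F Z) : heart T F Y := by
  obtain ⟨⟨_, hX0⟩, ⟨_, hX1⟩⟩ := hX
  obtain ⟨⟨_, hZ0⟩, ⟨_, hZ1⟩⟩ := hZ
  refine ⟨⟨isLE_of_triangle₂ hT 0, ?_⟩, ⟨isGE_of_triangle₂ hT (-1), ?_⟩⟩
  · obtain ⟨w, hw⟩ := exact_homology₂ hT 0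
    exact h.torsion_of_exact hw (epi_homology_map₂ hT 0 1 rfl (isZero_of_isLE X 0 1 (by simp)))
      hX0 hZ0
  · obtain ⟨w, hw⟩ := exact_homology₂ hT (-1)
    exact h.torsionFree_of_exact hw
      (mono_homology_map₁ hT (-2) (-1) rfl (isZero_of_isGE Z (-1) (-2) (by simp))) hX1 hZ1

/-- A morphism with cone in the shifted aisle is epi as seen from the coaisle; `shiftedAisle_of_epi`
is the converse within the heart. -/
lemma eq_zero_of_comp_eq_zero (hZ : shiftedAisle T Z) {W : DerivedCategory C}
    (hW : coaisle F W) (k : Y ⟶ W) (hk : f ≫ k = 0) : k = 0 := by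
  obtain ⟨l, rfl⟩ := exists_desc_of_triangle hT k hk
  rw [h.hom_eq_zero_of_shiftedAisle hZ hW l, comp_zero]

lemma shiftedAisle_of_epi (hX : heart T F X) (hY : heart T F Y)
    (hf : ∀ W, heart T F W → ∀ k : Y ⟶ W, f ≫ k = 0 → k = 0) : shiftedAisle T Z := by
  have hX1 := shiftedAisle_shift hX.1
  obtain ⟨⟨_, hX0⟩, ⟨_, _⟩⟩ := hX
  obtain ⟨⟨_, hY0⟩, ⟨_, _⟩⟩ := hY
  have key : ∀ W, heart T F W → ∀ k : Z ⟶ W, k = 0 := fun W hW k => by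
    obtain ⟨l, rfl⟩ := exists_desc_of_triangle₃ hT k
      (hf W hW _ (by rw [← Category.assoc, triangle_comp₁₂ hT, zero_comp]))
    rw [h.hom_eq_zero_of_shiftedAisle hX1 hW.2 l, comp_zero]
  have : X.IsLE (0 + 1) := TStructure.t.isLE_of_le _ 0 _
  have : Z.IsLE 0 := isLE_of_triangle₃ hT 0 _ rfl
  have hZ : Z.IsLE (-1) := by
    rw [isLE_iff]
    intro i hi
    rcases (show 0 ≤ i by lia).eq_or_lt with rfl | hi
    -- `H^0(Z)` is a quotient of `H^0(Y)`, hence torsion. Its stalk lies in the heart, so the map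
    -- from `Z` onto it is zero although it is an isomorphism on `H^0`.
    · obtain ⟨Z', M, j, p, ε, hT', _, _⟩ := exists_stalk_truncation_le Z 0 (-1) (by simp)
      have := epi_homology_map₂ hT 0 1 rfl (isZero_of_isLE X 0 1 (by simp))
      have hM : T M := T.prop_of_iso
        (asIso ((homologyFunctor C 0).map p) ≪≫ homologyStalkIso 0 M)
        (h.torsion_of_epi ((homologyFunctor C 0).map g) hY0)
      have hp : (homologyFunctor C 0).map p = 0 := by
        rw [key _ (h.heart_stalk hM) p, Functor.map_zero]
      rw [IsZero.iff_id_eq_zero, ← cancel_mono ((homologyFunctor C 0).map p), hp]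
      simp
    · exact isZero_of_isLE Z 0 i hi
  refine ⟨hZ, ?_⟩
  obtain ⟨Z', N, j, p, ε, hT', _, _⟩ := exists_stalk_truncation_le Z (-1) (-2) (by simp)
  obtain ⟨A, B, hA, hB, a, b, w, hS⟩ := h.exists_shortExact N
  -- The shifted stalk of the torsion-free quotient `B` of `H^{-1}(Z)` lies in the heart, so it
  -- receives only the zero map from `Z`.
  have hb : b = 0 := by
    have h1 := key _ (h.heart_stalk_shift hB) (p ≫ (singleFunctor C (-1)).map b)
    have h2 : (homologyFunctor C (-1)).map ((singleFunctor C (-1)).map b) = 0 := by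
      rw [← cancel_epi ((homologyFunctor C (-1)).map p), ← Functor.map_comp, h1]
      simp
    have h3 := (singleFunctorCompHomologyFunctorIso C (-1)).hom.naturality b
    rw [← cancel_epi ((singleFunctorCompHomologyFunctorIso C (-1)).hom.app N)]
    simpa [h2] using h3.symm
  have := hS.exact.epi_f hb
  exact T.prop_of_iso (asIso ((homologyFunctor C (-1)).map p) ≪≫ homologyStalkIso (-1) N).symm
    (h.torsion_of_epi a hA)

end IsTorsionPair

lemma exists_heart_triangle {X : DerivedCategory C} (hX : heart T F X) :
    ∃ (B A : C) (_ : F B) (_ : T A) (i : (singleFunctor C (-1)).obj B ⟶ X)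
      (p : X ⟶ (singleFunctor C 0).obj A)
      (δ : (singleFunctor C 0).obj A ⟶ ((singleFunctor C (-1)).obj B)⟦(1 : ℤ)⟧),
      Triangle.mk i p δ ∈ distTriang _ := by
  obtain ⟨⟨_, hX0⟩, ⟨_, hX1⟩⟩ := hX
  obtain ⟨X', B, i, p, δ, hT, _, _⟩ := exists_stalk_truncation_ge X (-1) 0 (by simp)
  have hB : F B := F.prop_of_iso
    ((asIso ((homologyFunctor C (-1)).map i)).symm ≪≫ homologyStalkIso (-1) B) hX1
  have : ((singleFunctor C (-1)).obj B).IsLE (0 + 1) := TStructure.t.isLE_of_le _ (-1) _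
  have : X'.IsLE 0 := isLE_of_triangle₃ hT 0 _ rfl
  obtain ⟨A, ⟨e⟩⟩ := exists_iso_singleFunctor_obj_of_isGE_of_isLE X' 0
  have := mono_homology_map₂ hT 0 (isZero_homology_stalk (-1) 0 (by simp) B)
  have := epi_homology_map₂ hT 0 1 rfl (isZero_homology_stalk (-1) 1 (by simp) B)
  have : IsIso ((homologyFunctor C 0).map p) := isIso_of_mono_of_epi _
  have hA : T A := T.prop_of_iso (asIso ((homologyFunctor C 0).map p) ≪≫
    (homologyFunctor C 0).mapIso e ≪≫ homologyStalkIso 0 A) hX0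
  exact ⟨B, A, hB, hA, i, p ≫ e.hom, _, distinguished_of_iso hT (Iso.refl _) (Iso.refl _) e.symm
    (by simp) (by simp)⟩

end HeartLemmas

/-! ### Tilting torsion pairs: the stalk of `V` is a projective generator -/

section TiltingTorsionPair

lemma IsTorsionPair.torsion_coproduct {C : Type u} [Category.{v} C] [Abelian C]
    {T F : ObjectProperty C} [T.IsClosedUnderIsomorphisms] (h : IsTorsionPair T F)
    {I : Type t} {A : I → C} {c : Cofan A} (hc : IsColimit c) (hA : ∀ i, T (A i)) : T c.pt :=
  h.torsion_of_hom_eq_zero fun Y hY f => Cofan.IsColimit.hom_ext hc _ _ fun i => by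
    rw [h.hom_eq_zero (hA i) hY (c.inj i ≫ f), comp_zero]

variable {C : Type u} [Category.{v} C] [Abelian C] [HasDerivedCategory.{w} C]

/-- The conditions on a torsion pair `(T, F)` and an object `V` which make the stalk complex of `V`
a projective generator of the heart. -/
structure IsTiltingTorsionPair (T F : ObjectProperty C) (V : C) : Prop where
  torsionPair : IsTorsionPair T F
  self : T V
  presentation : ∀ X, T X → ∃ (I : Type v) (c : Cofan fun _ : I => V) (_ : IsColimit c) (K : C)
    (_ : T K) (i : K ⟶ c.pt) (p : c.pt ⟶ X) (w : i ≫ p = 0), (ShortComplex.mk i p w).ShortExact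
  hom_shift_one : ∀ X, T X →
    ∀ f : (singleFunctor C 0).obj V ⟶ (singleFunctor C (-1)).obj X, f = 0
  hom_shift_two : ∀ X, F X →
    ∀ f : (singleFunctor C 0).obj V ⟶ (singleFunctor C (-2)).obj X, f = 0
  embeds : ∀ X, F X → ∃ (Y : C) (_ : T Y) (i : X ⟶ Y), Mono i

variable {T F : ObjectProperty C}

lemma rotate_triangle {X Y Z : DerivedCategory C} {f : X ⟶ Y} {g : Y ⟶ Z} {δ : Z ⟶ X⟦(1 : ℤ)⟧}
    (hT : Triangle.mk f g δ ∈ distTriang _) : Triangle.mk g δ (-f⟦(1 : ℤ)⟧') ∈ distTriang _ :=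
  rot_of_distTriang _ hT

lemma exists_stalk_triangle {A B D : C} {i : A ⟶ B} {p : B ⟶ D} {w : i ≫ p = 0}
    (hS : (ShortComplex.mk i p w).ShortExact) :
    ∃ δ : (singleFunctor C 0).obj D ⟶ ((singleFunctor C 0).obj A)⟦(1 : ℤ)⟧,
      Triangle.mk ((singleFunctor C 0).map i) ((singleFunctor C 0).map p) δ ∈ distTriang _ :=
  ⟨hS.singleδ, hS.singleTriangle_distinguished⟩

/-- A short exact sequence `0 → A → B → D → 0` gives a triangle `B[0] → D[0] → A[1] → B[1]`. -/
lemma exists_triangle_of_shortExact {A B D : C} {i : A ⟶ B} {p : B ⟶ D} {w : i ≫ p = 0}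
    (hS : (ShortComplex.mk i p w).ShortExact) :
    ∃ (δ : (singleFunctor C 0).obj D ⟶ (singleFunctor C (-1)).obj A)
      (ε : (singleFunctor C (-1)).obj A ⟶ ((singleFunctor C 0).obj B)⟦(1 : ℤ)⟧),
      Triangle.mk ((singleFunctor C 0).map p) δ ε ∈ distTriang _ := by
  obtain ⟨δ, hδ⟩ := exists_stalk_triangle hS
  exact ⟨δ ≫ (stalkShiftIso 0 (-1) (by simp) A).hom, _,
    distinguished_of_iso (rotate_triangle hδ) (Iso.refl _) (Iso.refl _)
      (stalkShiftIso 0 (-1) (by simp) A).symm (by simp) (by simp)⟩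

namespace IsTiltingTorsionPair

variable {V : C} (h : IsTiltingTorsionPair T F V)
include h

/-- The obstruction lies in `Hom(V[0], B[2])`, which vanishes for torsion-free `B`. -/
lemma exists_lift_stalk {X : DerivedCategory C} {A B : C} (hB : F B)
    {i : (singleFunctor C (-1)).obj B ⟶ X} {p : X ⟶ (singleFunctor C 0).obj A}
    {δ : (singleFunctor C 0).obj A ⟶ ((singleFunctor C (-1)).obj B)⟦(1 : ℤ)⟧}
    (hT : Triangle.mk i p δ ∈ distTriang _) (f : (singleFunctor C 0).obj V ⟶ _) :
    ∃ l, f = l ≫ p := by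
  refine exists_lift_of_triangle₃ hT f ?_
  rw [← cancel_mono (stalkShiftIso (-1) (-2) (by simp) B).hom, zero_comp]
  exact h.hom_shift_two B hB _

variable [T.IsClosedUnderIsomorphisms] [F.IsClosedUnderIsomorphisms]

lemma heart_self : heart T F ((singleFunctor C 0).obj V) := h.torsionPair.heart_stalk h.self

/-- `Z` is an extension of a torsion object in degree `-1` by a torsion-free one in degree `-2`, so
the two Ext conditions apply one after the other. Cones of epimorphisms in the heart have this
shape. -/
lemma hom_eq_zero_of_shiftedAisle {Z : DerivedCategory C} (hZ : shiftedAisle T Z) [Z.IsGE (-2)]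
    (hF : F ((homologyFunctor C (-2)).obj Z)) (f : (singleFunctor C 0).obj V ⟶ Z) : f = 0 := by
  obtain ⟨_, hZ⟩ := hZ
  obtain ⟨Z', B, i, p, δ, hT, _, _⟩ := exists_stalk_truncation_ge Z (-2) (-1) (by simp)
  have hB : F B := F.prop_of_iso
    ((asIso ((homologyFunctor C (-2)).map i)).symm ≪≫ homologyStalkIso (-2) B) hF
  have : ((singleFunctor C (-2)).obj B).IsLE (-1 + 1) := TStructure.t.isLE_of_le _ (-2) _
  have : Z'.IsLE (-1) := isLE_of_triangle₃ hT (-1) _ rfl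
  obtain ⟨A, ⟨e⟩⟩ := exists_iso_singleFunctor_obj_of_isGE_of_isLE Z' (-1)
  have := mono_homology_map₂ hT (-1) (isZero_homology_stalk (-2) (-1) (by simp) B)
  have := epi_homology_map₂ hT (-1) 0 rfl (isZero_homology_stalk (-2) 0 (by simp) B)
  have : IsIso ((homologyFunctor C (-1)).map p) := isIso_of_mono_of_epi _
  have hA : T A := T.prop_of_iso (asIso ((homologyFunctor C (-1)).map p) ≪≫
    (homologyFunctor C (-1)).mapIso e ≪≫ homologyStalkIso (-1) A) hZ
  have hfp : f ≫ p = 0 := by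
    rw [← cancel_mono e.hom, h.hom_shift_one A hA ((f ≫ p) ≫ e.hom), zero_comp]
  obtain ⟨g, rfl⟩ := exists_lift_of_triangle hT f hfp
  rw [h.hom_shift_two B hB g, zero_comp]

/-- The stalk complex of `V` is projective in the heart. -/
lemma exists_lift {X Y : DerivedCategory C} (hX : heart T F X) (hY : heart T F Y) (e : X ⟶ Y)
    (he : ∀ W, heart T F W → ∀ k : Y ⟶ W, e ≫ k = 0 → k = 0)
    (f : (singleFunctor C 0).obj V ⟶ Y) : ∃ g, f = g ≫ e := by
  obtain ⟨Z, g, δ, hT⟩ := distinguished_cocone_triangle e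
  have hZ := h.torsionPair.shiftedAisle_of_epi hT hX hY he
  obtain ⟨-, ⟨_, hX1⟩⟩ := hX
  obtain ⟨-, ⟨_, hY1⟩⟩ := hY
  have : X.IsGE (-2 + 1) := TStructure.t.isGE_of_ge _ _ (-1)
  have : Y.IsGE (-2) := TStructure.t.isGE_of_ge _ _ (-1)
  have : Z.IsGE (-2) := isGE_of_triangle₃ hT (-2) _ rfl
  obtain ⟨d, w, _, -⟩ := exists_mono_homology₃ hT (-2) (-1) rfl
    (isZero_of_isGE Y (-1) (-2) (by simp))
  have hF := h.torsionPair.torsionFree_of_mono d hX1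
  exact exists_lift_of_triangle hT f (h.hom_eq_zero_of_shiftedAisle hZ hF _)

variable [EnoughInjectives C]

/-- The epimorphism `V^(I) → A` has torsion kernel `K`, so the cone `K[1]` of its stalk lies in the
shifted aisle. -/
lemma stalk_hom_eq_zero {A : C} (hA : T A) {Y : DerivedCategory C} (hY : coaisle F Y)
    (k : (singleFunctor C 0).obj A ⟶ Y)
    (hk : ∀ g : V ⟶ A, (singleFunctor C 0).map g ≫ k = 0) : k = 0 := by
  obtain ⟨I, c, hc, K, hK, i, p, w, hS⟩ := h.presentation A hA
  have := hY.1
  have h1 : (singleFunctor C 0).map p ≫ k = 0 := stalk_coproduct_hom_ext hc (-1) fun j => by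
    rw [← Category.assoc, ← Functor.map_comp, hk, comp_zero]
  obtain ⟨δ, hδ⟩ := exists_stalk_triangle hS
  exact h.torsionPair.eq_zero_of_comp_eq_zero (rotate_triangle hδ)
    (shiftedAisle_shift (aisle_stalk hK)) hY k h1

/-- Embedding `B` in a torsion object `A` gives `(A/B)[0] → B[1]` with cone `A[1]` in the shifted
aisle, which reduces the claim to the torsion object `A/B`. -/
lemma stalk_shift_hom_eq_zero {B : C} (hB : F B) {Y : DerivedCategory C} (hY : coaisle F Y)
    (k : (singleFunctor C (-1)).obj B ⟶ Y)
    (hk : ∀ g : (singleFunctor C 0).obj V ⟶ (singleFunctor C (-1)).obj B, g ≫ k = 0) : k = 0 := by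
  obtain ⟨A, hA, i, _⟩ := h.embeds B hB
  have hS : (ShortComplex.mk i (cokernel.π i) (by simp)).ShortExact :=
    { exact := ShortComplex.exact_cokernel i }
  obtain ⟨δ, ε, hT⟩ := exists_triangle_of_shortExact hS
  refine h.torsionPair.eq_zero_of_comp_eq_zero (rotate_triangle hT)
    (shiftedAisle_shift (aisle_stalk hA)) hY k ?_
  refine h.stalk_hom_eq_zero (h.torsionPair.torsion_of_epi (cokernel.π i) hA) hY _ fun g => ?_
  rw [← Category.assoc]
  exact hk _

/-- The stalk complex of `V` is a generator of the heart. -/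
lemma hom_eq_zero {X Y : DerivedCategory C} (hX : heart T F X) (hY : coaisle F Y) (f : X ⟶ Y)
    (hf : ∀ g : (singleFunctor C 0).obj V ⟶ X, g ≫ f = 0) : f = 0 := by
  obtain ⟨B, A, hB, hA, i, p, δ, hT⟩ := exists_heart_triangle hX
  obtain ⟨k, rfl⟩ := exists_desc_of_triangle hT f
    (h.stalk_shift_hom_eq_zero hB hY _ fun g => by rw [← Category.assoc]; exact hf _)
  rw [h.stalk_hom_eq_zero hA hY k fun g => ?_, comp_zero]
  obtain ⟨l, hl⟩ := h.exists_lift_stalk hB hT ((singleFunctor C 0).map g)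
  rw [hl, Category.assoc]
  exact hf l

/-- Every object of the heart is the cone of a morphism `M ⟶ V^(I)` between torsion objects. -/
lemma exists_presentation [HasCoproducts.{v} C] {X : DerivedCategory C} (hX : heart T F X) :
    ∃ (I : Type v) (c : Cofan fun _ : I => V) (_ : IsColimit c) (M : C) (_ : T M)
      (a : M ⟶ c.pt) (p : (singleFunctor C 0).obj c.pt ⟶ X)
      (δ : X ⟶ ((singleFunctor C 0).obj M)⟦(1 : ℤ)⟧),
      Triangle.mk ((singleFunctor C 0).map a) p δ ∈ distTriang _ := by
  have := hX.2.1
  have := small_hom_stalk V X (-1)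
  let I : Type v := Shrink.{v} ((singleFunctor C 0).obj V ⟶ X)
  let c : Cofan fun _ : I => V := Cofan.mk _ (Sigma.ι fun _ : I => V)
  have hc : IsColimit c := coproductIsCoproduct _
  obtain ⟨p, hp⟩ := exists_stalk_coproduct_desc hc (-1) fun i : I => (equivShrink _).symm i
  have hcT := h.torsionPair.torsion_coproduct hc fun _ => h.self
  have hp' : ∀ W, heart T F W → ∀ k : X ⟶ W, p ≫ k = 0 → k = 0 := fun W hW k hk =>
    h.hom_eq_zero hX hW.2 k fun g => by
      have := hp (equivShrink _ g)
      rw [Equiv.symm_apply_apply] at this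
      rw [← this, Category.assoc, hk, comp_zero]
  obtain ⟨W, a, δ, hT⟩ := distinguished_cocone_triangle₁ p
  -- The sum of all maps from `V[0]` is epi in the heart, so `W[1]` lies in the shifted aisle. This
  -- bounds `W` above by degree 0; the triangle bounds it below, so `W` is a torsion stalk.
  have hW := h.torsionPair.shiftedAisle_of_epi (rotate_triangle hT)
    (h.torsionPair.heart_stalk hcT) hX hp'
  have hWle : W.IsLE 0 := by
    have : (W⟦(1 : ℤ)⟧).IsLE (-1) := hW.1
    exact TStructure.t.isLE_of_shift W 0 1 (-1)
  have : W.IsGE 0 := isGE_of_triangle₁ hT (-1) 0 (by simp)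
  obtain ⟨M, ⟨e⟩⟩ := exists_iso_singleFunctor_obj_of_isGE_of_isLE W 0
  have hM : T M := T.prop_of_iso ((homologyShiftIso W 1 (-1) 0 (by simp)) ≪≫
    (homologyFunctor C 0).mapIso e ≪≫ homologyStalkIso 0 M) hW.2
  obtain ⟨a', ha'⟩ := (singleFunctor C 0).map_surjective (e.inv ≫ a)
  exact ⟨I, c, hc, M, hM, a', p, _, distinguished_of_iso hT e.symm (Iso.refl _) (Iso.refl _)
    (by simp [ha']) (by simp)⟩

end IsTiltingTorsionPair

end TiltingTorsionPair

/-! ### The coproduct comparison map -/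

section Compact

variable {C : Type u} [Category.{v} C] [Preadditive C]

@[simp]
lemma coproductComparison_of {P : C} {I : Type t} [hI : DecidableEq I] {X : I → C} (c : Cofan X)
    (i : I) (f : P ⟶ X i) :
    coproductComparison P c (DirectSum.of (fun i => P ⟶ X i) i f) = f ≫ c.inj i := by
  obtain rfl : hI = fun a b => Classical.propDecidable (a = b) := Subsingleton.elim _ _
  classical
  exact DirectSum.toAddMonoid_of (fun i => Preadditive.rightComp P (c.inj i)) i f

lemma coproductComparison_injective (P : C) {I : Type t} {X : I → C} {c : Cofan X}
    (hc : IsColimit c) : Function.Injective (coproductComparison P c) := by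
  classical
  rw [injective_iff_map_eq_zero]
  intro x hx
  ext j
  let π : c.pt ⟶ X j := Cofan.IsColimit.desc hc fun i =>
    if h : i = j then eqToHom (by rw [h]) else 0
  have key : ∀ y, coproductComparison P c y ≫ π = y j := by
    intro y
    induction y using DirectSum.induction_on with
    | zero => simp
    | of i f =>
      rw [coproductComparison_of]
      by_cases h : i = j
      · subst h
        simp [π]
      · rw [DirectSum.of_eq_of_ne _ _ _ (Ne.symm h)]
        simp [π, h]
    | add y z hy hz => rw [map_add, Preadditive.add_comp, hy, hz]; rfl
  rw [← key x, hx]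
  simp

/-- Finite support expressed through test maps out of the coproduct. This form needs no description
of finite subcoproducts in the heart. -/
lemma exists_finset_of_coproductComparison {P : C} {I : Type t} {X : I → C} (c : Cofan X)
    (x : ⨁ i, (P ⟶ X i)) : ∃ s : Finset I, ∀ (Z : C) (g : c.pt ⟶ Z),
      (∀ i ∈ s, c.inj i ≫ g = 0) → coproductComparison P c x ≫ g = 0 := by
  classical
  induction x using DirectSum.induction_on with
  | zero => exact ⟨∅, fun Z g _ => by simp⟩
  | of i f =>
    refine ⟨{i}, fun Z g hg => ?_⟩
    rw [coproductComparison_of, Category.assoc, hg i (by simp), comp_zero]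
  | add x y hx hy =>
    obtain ⟨s, hs⟩ := hx
    obtain ⟨s', hs'⟩ := hy
    refine ⟨s ∪ s', fun Z g hg => ?_⟩
    rw [map_add, Preadditive.add_comp, hs Z g fun i hi => hg i (by simp [hi]),
      hs' Z g fun i hi => hg i (by simp [hi]), add_zero]

end Compact

/-! ### Compactness from self-smallness -/

section Progenerator

variable {C : Type u} [Category.{v} C] [Abelian C] [HasDerivedCategory.{w} C]
  {T F : ObjectProperty C} [T.IsClosedUnderIsomorphisms] [F.IsClosedUnderIsomorphisms]
  [EnoughInjectives C] [HasCoproducts.{v} C] {V : C}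

theorem IsTiltingTorsionPair.isProgenerator (h : IsTiltingTorsionPair T F V)
    (hV : IsSelfSmall V) :
    IsProgenerator.{v} (⟨_, h.heart_self⟩ : (heart T F).FullSubcategory) where
  projective := ⟨fun {E X} f e _ => by
    obtain ⟨g, hg⟩ := h.exists_lift E.property X.property e.hom (fun W hW k hk => by
      have : e ≫ (ObjectProperty.homMk k : X ⟶ ⟨W, hW⟩) = 0 := by
        ext; exact hk
      have := (cancel_epi e).1 (this.trans comp_zero.symm)
      exact congr_arg (fun l => l.hom) this) f.hom
    exact ⟨ObjectProperty.homMk g, by ext; exact hg.symm⟩⟩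
  generator := by
    rw [Preadditive.isSeparator_iff]
    intro X Y f hf
    ext
    exact h.hom_eq_zero X.property Y.property.2 f.hom fun g =>
      congr_arg (fun l => l.hom) (hf (ObjectProperty.homMk g))
  compact I X c hc := by
    refine ⟨coproductComparison_injective _ hc, fun f => ?_⟩
    have hX : ∀ i, Small.{v} ((singleFunctor C 0).obj V ⟶ (X i).obj) := fun i => by
      have := (X i).property.2.1
      exact small_hom_stalk V _ (-1)
    -- One copy of `V` for each summand and each map from `V[0]` into it. The resulting `p` is epi
    -- in the heart because `V[0]` generates, so `f` lifts to a map `V → V^(S)`; self-smallness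
    -- makes that lift a finite sum, which is pushed back to the summands `X i`.
    let S : Type v := Σ i, Shrink.{v} ((singleFunctor C 0).obj V ⟶ (X i).obj)
    let d : Cofan fun _ : S => V := Cofan.mk _ (Sigma.ι fun _ : S => V)
    have hd : IsColimit d := coproductIsCoproduct _
    have := c.pt.property.2.1
    obtain ⟨p, hp⟩ := exists_stalk_coproduct_desc (Y := c.pt.obj) hd (-1)
      fun s : S => (equivShrink _).symm s.2 ≫ (c.inj s.1).hom
    have hdT := h.torsionPair.torsion_coproduct hd fun _ => h.self
    obtain ⟨l, hl⟩ := h.exists_lift (h.torsionPair.heart_stalk hdT) c.pt.property p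
      (fun W hW k hk => by
        have : (ObjectProperty.homMk k : c.pt ⟶ ⟨W, hW⟩) = 0 := by
          refine Cofan.IsColimit.hom_ext hc _ _ fun i => ?_
          ext
          rw [comp_zero]
          refine h.hom_eq_zero (X i).property hW.2 _ fun g => ?_
          have hg := hp ⟨i, equivShrink _ g⟩
          rw [Equiv.symm_apply_apply] at hg
          calc g ≫ (c.inj i).hom ≫ k = (g ≫ (c.inj i).hom) ≫ k := (Category.assoc _ _ _).symm
            _ = 0 := by rw [← hg, Category.assoc, hk, comp_zero]
        exact congr_arg (fun l => l.hom) this) f.hom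
    obtain ⟨m, rfl⟩ := (singleFunctor C 0).map_surjective l
    obtain ⟨x, rfl⟩ := (hV S d hd).2 m
    suffices ∀ x : ⨁ _ : S, (V ⟶ V), ∃ y, (coproductComparison _ c y).hom =
        (singleFunctor C 0).map (coproductComparison V d x) ≫ p by
      obtain ⟨y, hy⟩ := this x
      exact ⟨y, by ext; rw [hy, hl]⟩
    intro x
    classical
    induction x using DirectSum.induction_on with
    | zero => exact ⟨0, by simp⟩
    | of s g =>
      refine ⟨DirectSum.of _ s.1
        (ObjectProperty.homMk ((singleFunctor C 0).map g ≫ (equivShrink _).symm s.2)), ?_⟩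
      rw [coproductComparison_of, coproductComparison_of, Functor.map_comp, Category.assoc, hp]
      exact Category.assoc _ _ _
    | add x y hx hy =>
      obtain ⟨a, ha⟩ := hx
      obtain ⟨b, hb⟩ := hy
      exact ⟨a + b, by
        rw [map_add, map_add, Functor.map_add, Preadditive.add_comp, ← ha, ← hb]; rfl⟩

end Progenerator

/-! ### Vanishing of Ext: translations and dimension shifting -/

section Ext

variable {C : Type u} [Category.{v} C] [Abelian C] {V : C}

lemma kerExt_iff_ext (n : ℕ) (X : C) :
    kerExt n V X ↔ haveI := HasExt.standard C; ∀ x : Abelian.Ext.{max u v} V X n, x = 0 := by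
  have := HasExt.standard C
  exact ⟨fun _ x => Subsingleton.elim (h := by assumption) _ _,
    fun h => ⟨fun x y => by rw [h x, h y]⟩⟩

lemma kerExt_iff_hom [HasDerivedCategory.{w} C] (n : ℕ) (m : ℤ) (h : n + m = 0) (X : C) :
    kerExt n V X ↔ ∀ f : (singleFunctor C 0).obj V ⟶ (singleFunctor C m).obj X, f = 0 := by
  have := HasExt.standard C
  rw [kerExt_iff_ext]
  let e := ((singleFunctors C).shiftIso (n : ℤ) m 0 h).app X
  let φ := Abelian.Ext.homAddEquiv.{w, max u v} (X := V) (Y := X) (n := n)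
  constructor
  · intro H f
    have h1 : φ.symm (f ≫ e.inv) = 0 := H _
    rw [EmbeddingLike.map_eq_zero_iff] at h1
    rw [← cancel_mono e.inv]
    exact h1.trans zero_comp.symm
  · intro H x
    rw [← EmbeddingLike.map_eq_zero_iff (f := φ)]
    have h1 : φ x ≫ e.hom = 0 := H _
    have h2 := congr_arg (fun k => k ≫ e.inv) h1
    simpa using! h2

lemma kerExt_of_injective (n : ℕ) (X : C) [Injective X] : kerExt (n + 1) V X := by
  have := HasExt.standard C
  exact Abelian.Ext.subsingleton_of_injective V X n

variable {A B D : C} {i : A ⟶ B} {p : B ⟶ D} {w : i ≫ p = 0}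
  (hS : (ShortComplex.mk i p w).ShortExact)
include hS

lemma exists_lift_of_kerExt (h : kerExt 1 V A) (f : V ⟶ D) : ∃ g : V ⟶ B, g ≫ p = f := by
  have := HasExt.standard C
  rw [kerExt_iff_ext] at h
  obtain ⟨x, hx⟩ := Abelian.Ext.covariant_sequence_exact₃ V hS (Abelian.Ext.mk₀ f) rfl (h _)
  obtain ⟨g, rfl⟩ := (Abelian.Ext.mk₀_bijective _ _).2 x
  refine ⟨g, (Abelian.Ext.mk₀_bijective _ _).1 ?_⟩
  rw [← hx, Abelian.Ext.mk₀_comp_mk₀]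

/-- Every class in `Ext^1(V, A)` is the connecting image of some `V ⟶ D`, and the connecting map
kills whatever lifts to `B`. -/
lemma kerExt_one_of_lift (hB : kerExt 1 V B) (h : ∀ f : V ⟶ D, ∃ g : V ⟶ B, g ≫ p = f) :
    kerExt 1 V A := by
  have := HasExt.standard C
  rw [kerExt_iff_ext] at hB ⊢
  intro x
  obtain ⟨y, rfl⟩ := Abelian.Ext.covariant_sequence_exact₁ V hS x (hB _) (zero_add 1)
  obtain ⟨f, rfl⟩ := (Abelian.Ext.mk₀_bijective _ _).2 y
  obtain ⟨g, rfl⟩ := h f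
  rw [← Abelian.Ext.mk₀_comp_mk₀]
  have := hS.comp_extClass
  dsimp at this
  rw [Abelian.Ext.comp_assoc _ _ _ (add_zero 0) (zero_add 1) (by simp), this, Abelian.Ext.comp_zero]

lemma kerExt_two_of_kerExt_one [Injective B] (h : kerExt 1 V D) : kerExt 2 V A := by
  have := HasExt.standard C
  rw [kerExt_iff_ext] at h ⊢
  intro x
  obtain ⟨y, rfl⟩ := Abelian.Ext.covariant_sequence_exact₁ V hS x
    (Abelian.Ext.eq_zero_of_injective _) (show 1 + 1 = 2 from rfl)
  rw [h y, Abelian.Ext.zero_comp]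

end Ext

/-! ### The universal map from copies of `V` -/

section Gen

variable {C : Type u} [Category.{v} C] {V : C}

lemma gen_le_subgen : gen V ≤ subgen V := fun X hX => ⟨X, hX, 𝟙 X, inferInstance⟩

/-- The canonical morphism from a coproduct of copies of `V`. -/
lemma exists_universal_hom [HasCoproducts.{v} C] (V X : C) :
    ∃ (I : Type v) (c : Cofan fun _ : I => V) (_ : IsColimit c) (p : c.pt ⟶ X), (∀ f : V ⟶ X, ∃ g : V ⟶ c.pt, g ≫ p = f) ∧
      (gen V X → Epi p) := by
  let c : Cofan fun _ : (V ⟶ X) => V := Cofan.mk _ (Sigma.ι fun _ : (V ⟶ X) => V)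
  have hc : IsColimit c := coproductIsCoproduct _
  have key : ∀ f : V ⟶ X, ∃ g : V ⟶ c.pt, g ≫ Cofan.IsColimit.desc hc id = f := fun f =>
    ⟨c.inj f, by simp⟩
  refine ⟨V ⟶ X, c, hc, Cofan.IsColimit.desc hc id, key, ?_⟩
  rintro ⟨J, d, hd, q, _⟩
  choose g hg using fun j => key (d.inj j ≫ q)
  have : Cofan.IsColimit.desc hd g ≫ Cofan.IsColimit.desc hc id = q :=
    Cofan.IsColimit.hom_ext hd _ _ fun j => by simp [hg]
  exact epi_of_epi_fac this

end Gen

/-! ### The Ext conditions and the torsion pair generated by `V` -/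

section WeakTilting

variable {C : Type u} [Category.{v} C] [Abelian C] {V : C}

instance : (gen V).IsClosedUnderIsomorphisms where
  of_iso e hX := gen_of_epi e.hom hX

instance : (pres V).IsClosedUnderIsomorphisms where
  of_iso {X Y} e := by
    rintro ⟨I, J, c, hc, d, hd, f, p, w, hS, _⟩
    refine ⟨I, J, c, hc, d, hd, f, p ≫ e.hom, by rw [← Category.assoc, w, zero_comp], ?_,
      epi_comp _ _⟩
    exact (ShortComplex.exact_iff_of_iso (S₁ := ShortComplex.mk f p w)
      (S₂ := ShortComplex.mk f (p ≫ e.hom) (by rw [← Category.assoc, w, zero_comp]))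
      (ShortComplex.isoMk (Iso.refl _) (Iso.refl _) e (by simp) (by simp))).1 hS

instance : (kerHom V).IsClosedUnderIsomorphisms where
  of_iso e hX f := by
    rw [← cancel_mono e.inv, hX (f ≫ e.inv), zero_comp]

lemma pres_le_gen : pres V ≤ gen V := by
  rintro X ⟨I, J, c, hc, d, hd, f, p, w, hS, hp⟩
  exact ⟨I, c, hc, p, hp⟩

lemma exists_shortExact_of_pres {X : C} (hX : pres V X) :
    ∃ (I : Type v) (c : Cofan fun _ : I => V) (_ : IsColimit c) (K : C)
      (_ : gen V K) (i : K ⟶ c.pt) (p : c.pt ⟶ X) (w : i ≫ p = 0),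
      (ShortComplex.mk i p w).ShortExact := by
  obtain ⟨I, J, c, hc, d, hd, f, p, w, hS, hp⟩ := hX
  have : Epi (kernel.lift p f w) := hS.epi_kernelLift
  exact ⟨I, c, hc, kernel p, ⟨J, d, hd, kernel.lift p f w, inferInstance⟩, kernel.ι p, p,
    kernel.condition p, { exact := ShortComplex.exact_kernel p }⟩

lemma pres_of_shortExact {X K : C} {I : Type v} {c : Cofan fun _ : I => V} (hc : IsColimit c)
    (hK : gen V K) {i : K ⟶ c.pt} {p : c.pt ⟶ X} {w : i ≫ p = 0}
    (hS : (ShortComplex.mk i p w).ShortExact) : pres V X := by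
  obtain ⟨J, d, hd, q, hq⟩ := hK
  refine ⟨I, J, c, hc, d, hd, q ≫ i, p, by rw [Category.assoc, w, comp_zero], ?_, hS.epi_g⟩
  exact (ShortComplex.exact_iff_of_epi_of_isIso_of_mono
    (S₁ := ShortComplex.mk (q ≫ i) p (by rw [Category.assoc, w, comp_zero]))
    (S₂ := ShortComplex.mk i p w) ⟨q, 𝟙 _, 𝟙 _, by simp, by simp⟩).2 hS.exact

/-- The conditions on a module `V` which characterize, for self-small `V`, that its stalk complex
is a progenerator of the heart. -/
structure IsWeakTilting (V : C) : Prop where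
  pres_eq_gen : pres V = gen V
  gen_le_kerExt_one : gen V ≤ kerExt 1 V
  kerHom_le_kerExt_two : kerHom V ≤ kerExt 2 V
  embeds : ∀ X, kerHom V X → ∃ (Y : C) (_ : gen V Y) (i : X ⟶ Y), Mono i

lemma hom_eq_zero_of_gen {X Y : C} (hX : gen V X) (hY : kerHom V Y) (f : X ⟶ Y) : f = 0 := by
  obtain ⟨I, c, hc, p, _⟩ := hX
  rw [← cancel_epi p, comp_zero]
  exact Cofan.IsColimit.hom_ext hc _ _ fun i => by rw [hY (c.inj i ≫ p ≫ f), comp_zero]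

section

variable [HasCoproducts.{v} C]

lemma isTorsionPair_gen (h : gen V ≤ kerExt 1 V) : IsTorsionPair (gen V) (kerHom V) where
  hom_eq_zero X Y hX hY f := hom_eq_zero_of_gen hX hY f
  exists_shortExact X := by
    -- The image of the universal map is the trace of `V` in `X`. A map from `V` to the quotient
    -- lifts to `X`, as `Ext^1` of `V` into the trace is zero; the lift lands in the trace, so the
    -- original map vanishes.
    obtain ⟨I, c, hc, p, hp, -⟩ := exists_universal_hom V X
    have hS : (ShortComplex.mk (image.ι p) (cokernel.π (image.ι p)) (by simp)).ShortExact :=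
      { exact := ShortComplex.exact_cokernel _ }
    have hI : gen V (image p) := ⟨I, c, hc, factorThruImage p, inferInstance⟩
    refine ⟨image p, cokernel (image.ι p), hI, fun f => ?_, _, _, _, hS⟩
    obtain ⟨g, rfl⟩ := exists_lift_of_kerExt hS (h _ hI) f
    obtain ⟨k, rfl⟩ := hp g
    have hk : p ≫ cokernel.π (image.ι p) = 0 :=
      calc p ≫ cokernel.π (image.ι p)
          = factorThruImage p ≫ image.ι p ≫ cokernel.π (image.ι p) := by rw [image.fac_assoc]
        _ = 0 := by simp
    rw [Category.assoc, hk, comp_zero]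

lemma IsWeakTilting.isTiltingTorsionPair [HasDerivedCategory.{w} C] (h : IsWeakTilting V) :
    IsTiltingTorsionPair (gen V) (kerHom V) V where
  torsionPair := isTorsionPair_gen h.gen_le_kerExt_one
  self := gen_self V
  presentation X hX := exists_shortExact_of_pres (h.pres_eq_gen ▸ hX)
  hom_shift_one X hX := (kerExt_iff_hom 1 (-1) (by simp) X).1 (h.gen_le_kerExt_one X hX)
  hom_shift_two X hX := (kerExt_iff_hom 2 (-2) (by simp) X).1 (h.kerHom_le_kerExt_two X hX)
  embeds := h.embeds

/-- The kernel of the universal map lies in `Ker Ext^1`, hence in `Gen V`, which gives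
presentations. Injectives lie in `Ker Ext^1 = Gen V`, so every object embeds in `Gen V` and, as `Gen
V` is closed under quotients, dimension shifting makes `Ext^2(V, -)` vanish everywhere. -/
lemma isWeakTilting_of_gen_eq [EnoughInjectives C] (h : gen V = kerExt 1 V) :
    IsWeakTilting V where
  pres_eq_gen := le_antisymm pres_le_gen fun X hX => by
    obtain ⟨I, c, hc, p, hp, hp'⟩ := exists_universal_hom V X
    have := hp' hX
    have hS : (ShortComplex.mk (kernel.ι p) p (kernel.condition p)).ShortExact :=
      { exact := ShortComplex.exact_kernel p }
    refine pres_of_shortExact hc ?_ hS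
    rw [h]
    exact kerExt_one_of_lift hS (h ▸ ⟨I, c, hc, 𝟙 _, inferInstance⟩) hp
  gen_le_kerExt_one := h.le
  kerHom_le_kerExt_two X _ := by
    have hS : (ShortComplex.mk (Injective.ι X) (cokernel.π (Injective.ι X)) (by simp)).ShortExact :=
      { exact := ShortComplex.exact_cokernel _ }
    refine kerExt_two_of_kerExt_one hS ?_
    rw [← h]
    refine gen_of_epi (cokernel.π (Injective.ι X)) ?_
    rw [h]
    exact kerExt_of_injective 0 _
  embeds X _ := ⟨Injective.under X, h ▸ kerExt_of_injective 0 _, Injective.ι X, inferInstance⟩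

end

end WeakTilting

/-! ### Coproducts of modules and the implications towards condition 2) -/

section Module

variable {R : Type u} [Ring R]

lemma exists_sum_inj_eq {I : Type t} {X : I → ModuleCat.{u} R} {c : Cofan X} (hc : IsColimit c)
    (π : ∀ j, c.pt ⟶ X j) (hπ : ∀ j, c.inj j ≫ π j = 𝟙 _) (hπ' : ∀ i j, i ≠ j → c.inj i ≫ π j = 0)
    (y : c.pt) : ∃ s : Finset I, ∀ s', s ⊆ s' → ∑ j ∈ s', c.inj j (π j y) = y := by
  classical
  let N : Submodule R c.pt :=
    { carrier := {y | ∃ s : Finset I, ∀ s', s ⊆ s' → ∑ j ∈ s', c.inj j (π j y) = y}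
      zero_mem' := ⟨∅, by simp⟩
      add_mem' := by
        rintro a b ⟨s, hs⟩ ⟨s', hs'⟩
        refine ⟨s ∪ s', fun s'' h => ?_⟩
        simp only [map_add, Finset.sum_add_distrib]
        rw [hs _ (Finset.union_subset_left h), hs' _ (Finset.union_subset_right h)]
      smul_mem' := by
        rintro r a ⟨s, hs⟩
        refine ⟨s, fun s'' h => ?_⟩
        simp only [map_smul]
        rw [← Finset.smul_sum, hs _ h] }
  have hN : ∀ i (x : X i), c.inj i x ∈ N := fun i x => by
    refine ⟨{i}, fun s hs => ?_⟩
    rw [Finset.sum_eq_single_of_mem i (hs (by simp))]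
    · rw [← ConcreteCategory.comp_apply (c.inj i), hπ]; rfl
    · intro j _ hj
      rw [← ConcreteCategory.comp_apply (c.inj i), hπ' _ _ hj.symm]
      simp
  -- `N` contains the image of every summand, so the quotient map by `N` vanishes on all of them and
  -- `N` is everything.
  have key : ModuleCat.ofHom N.mkQ = 0 := Cofan.IsColimit.hom_ext hc _ _ fun i => by
    ext x
    simpa using hN i x
  have hy : N.mkQ y = 0 := congr_arg (fun k => k.hom y) key
  exact (Submodule.Quotient.mk_eq_zero N).1 hy

lemma coproductComparison_surjective (V : ModuleCat.{u} R) [Module.Finite R V] {I : Type t}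
    {X : I → ModuleCat.{u} R} {c : Cofan X} (hc : IsColimit c) :
    Function.Surjective (coproductComparison V c) := by
  classical
  intro f
  let π : ∀ j, c.pt ⟶ X j := fun j => Cofan.IsColimit.desc hc fun i =>
    if h : i = j then eqToHom (by rw [h]) else 0
  have hπ : ∀ j, c.inj j ≫ π j = 𝟙 _ := fun j => by simp [π]
  have hπ' : ∀ i j, i ≠ j → c.inj i ≫ π j = 0 := fun i j h => by simp [π, h]
  obtain ⟨S, hS⟩ := (Module.finite_def (R := R) (M := V)).1 inferInstance
  choose s hs using exists_sum_inj_eq hc π hπ hπ'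
  let t := S.biUnion fun v => s (f v)
  refine ⟨∑ j ∈ t, DirectSum.of (fun i => V ⟶ X i) j (f ≫ π j), ?_⟩
  ext v
  have hv : v ∈ Submodule.span R (S : Set V) := hS ▸ Submodule.mem_top
  rw [map_sum]
  simp only [coproductComparison_of]
  induction hv using Submodule.span_induction with
  | mem v hv =>
    refine Eq.trans ?_ (hs (f v) t (Finset.subset_biUnion_of_mem (fun v => s (f v)) hv))
    simp [ModuleCat.hom_sum]
  | zero => simp
  | add x y _ _ hx hy => rw [map_add, map_add, hx, hy]
  | smul r x _ hx => rw [map_smul, map_smul, hx]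

lemma isSelfSmall_of_finite (V : ModuleCat.{u} R) [Module.Finite R V] : IsSelfSmall V :=
  fun _ _ hc => ⟨coproductComparison_injective V hc, coproductComparison_surjective V hc⟩

lemma IsWeakTilting.stalkIsProgenerator {V : ModuleCat.{u} R}
    [HasDerivedCategory.{w} (ModuleCat.{u} R)] (h : IsWeakTilting V) (hV : IsSelfSmall V) :
    StalkIsProgenerator V := by
  rw [StalkIsProgenerator, h.pres_eq_gen]
  exact ⟨h.isTiltingTorsionPair.torsionPair, _, h.isTiltingTorsionPair.isProgenerator hV⟩

lemma IsClassicalOneTilting.stalkIsProgenerator {V : ModuleCat.{u} R}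
    [HasDerivedCategory.{w} (ModuleCat.{u} R)] (h : IsClassicalOneTilting V) :
    StalkIsProgenerator V :=
  (isWeakTilting_of_gen_eq h.gen_eq).stalkIsProgenerator h.selfSmall

lemma IsStalkProgeneratorModule.isWeakTilting {V : ModuleCat.{u} R}
    (h : IsStalkProgeneratorModule V) : IsWeakTilting V where
  pres_eq_gen := h.pres_eq_gen
  gen_le_kerExt_one := h.gen_le_kerExt_one
  kerHom_le_kerExt_two := h.kerHom_le_kerExt_two
  embeds X hX := by
    obtain ⟨Y, hY, i, hi⟩ := h.embeds X hX
    exact ⟨Y, pres_le_gen _ hY, i, hi⟩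

lemma IsStalkProgeneratorModule.stalkIsProgenerator {V : ModuleCat.{u} R}
    [HasDerivedCategory.{w} (ModuleCat.{u} R)] (h : IsStalkProgeneratorModule V) :
    StalkIsProgenerator V :=
  have := h.finitePresentation
  h.isWeakTilting.stalkIsProgenerator (isSelfSmall_of_finite V)

end Module

/-! ### What a progenerator stalk implies: Ext vanishing, embeddings, finiteness -/

section ProgeneratorConsequences

variable {C : Type u} [Category.{v} C] [Abelian C] [HasDerivedCategory.{w} C]
  {T F : ObjectProperty C} [T.IsClosedUnderIsomorphisms] [F.IsClosedUnderIsomorphisms]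
  {V : C}

section

variable (h : IsTorsionPair T F)
include h

lemma IsTorsionPair.heart_shift_stalk {A : C} (hA : F A) :
    heart T F (((singleFunctor C 0).obj A)⟦(1 : ℤ)⟧) :=
  (heart T F).prop_of_iso (stalkShiftIso 0 (-1) (by simp) A).symm (h.heart_stalk_shift hA)

/-- Completing `f` to a triangle gives an extension `X` of `P` by `A`. It stays in the heart, where
`X ⟶ P` is epi and hence split by projectivity, so `f` is zero. -/
lemma IsTorsionPair.hom_shift_eq_zero {P A : DerivedCategory C} (hP : heart T F P)
    (hproj : Projective (⟨P, hP⟩ : (heart T F).FullSubcategory)) (hA : heart T F A)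
    (f : P ⟶ A⟦(1 : ℤ)⟧) : f = 0 := by
  obtain ⟨X, i, g, hT⟩ := distinguished_cocone_triangle₂ f
  have hX := h.heart_of_triangle₂ hT hA hP
  let e : (⟨X, hX⟩ : (heart T F).FullSubcategory) ⟶ ⟨P, hP⟩ := ObjectProperty.homMk g
  have : Epi e := Preadditive.epi_of_cancel_zero _ fun {W} k hk => by
    obtain ⟨l, hl⟩ := exists_desc_of_triangle₃ hT k.hom (congr_arg (fun l => l.hom) hk)
    ext
    rw [hl, h.hom_eq_zero_of_shiftedAisle (shiftedAisle_shift hA.1) W.property.2 l, comp_zero]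
    rfl
  have hs : (Projective.factorThru (𝟙 _) e).hom ≫ g = 𝟙 P :=
    congr_arg (fun l => l.hom) (Projective.factorThru_comp (𝟙 _) e)
  rw [← Category.id_comp f, ← hs, Category.assoc, triangle_comp₂₃ hT, comp_zero]

lemma IsTorsionPair.kerExt_one (hV : heart T F ((singleFunctor C 0).obj V))
    (hproj : Projective (⟨_, hV⟩ : (heart T F).FullSubcategory)) {A : C} (hA : T A) :
    kerExt 1 V A := by
  rw [kerExt_iff_hom 1 (-1) (by simp)]
  intro f
  rw [← cancel_mono (stalkShiftIso 0 (-1) (by simp) A).inv, zero_comp]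
  exact h.hom_shift_eq_zero hV hproj (h.heart_stalk hA) _

lemma IsTorsionPair.kerExt_two (hV : heart T F ((singleFunctor C 0).obj V))
    (hproj : Projective (⟨_, hV⟩ : (heart T F).FullSubcategory)) {A : C} (hA : F A) :
    kerExt 2 V A := by
  rw [kerExt_iff_hom 2 (-2) (by simp)]
  intro f
  rw [← cancel_mono (stalkShiftIso (-1) (-2) (by simp) A).inv, zero_comp]
  exact h.hom_shift_eq_zero hV hproj (h.heart_stalk_shift hA) _

variable [EnoughInjectives C]

/-- The canonical map `V^(I)[0] → A[1]` is epi in the heart, so its cone has torsion `H^{-1}`. The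
source has no homology in degree `-1`, so `A` embeds there. -/
lemma IsTorsionPair.exists_mono_torsion [HasCoproducts.{v} C] (hTV : T V)
    (hV : heart T F ((singleFunctor C 0).obj V))
    (hsep : IsSeparator (⟨_, hV⟩ : (heart T F).FullSubcategory)) {A : C} (hA : F A) :
    ∃ (B : C) (_ : T B) (i : A ⟶ B), Mono i := by
  let Y := (singleFunctor C (-1)).obj A
  have hY : heart T F Y := h.heart_stalk_shift hA
  have := small_hom_stalk V Y (-1)
  let I := Shrink.{v} ((singleFunctor C 0).obj V ⟶ Y)
  let c : Cofan fun _ : I => V := Cofan.mk _ (Sigma.ι fun _ : I => V)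
  have hc : IsColimit c := coproductIsCoproduct _
  obtain ⟨e, he⟩ := exists_stalk_coproduct_desc hc (-1) fun i => (equivShrink _).symm i
  have hX : heart T F ((singleFunctor C 0).obj c.pt) :=
    h.heart_stalk (h.torsion_coproduct hc fun _ => hTV)
  obtain ⟨Z, g, δ, hT⟩ := distinguished_cocone_triangle e
  have hZ := h.shiftedAisle_of_epi hT hX hY fun W hW k hk => by
    have := (Preadditive.isSeparator_iff _).1 hsep
      (ObjectProperty.homMk k : (⟨Y, hY⟩ : (heart T F).FullSubcategory) ⟶ ⟨W, hW⟩) fun f => by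
        ext
        have := he (equivShrink _ f.hom)
        rw [Equiv.symm_apply_apply] at this
        change f.hom ≫ k = 0
        rw [← this, Category.assoc, hk, comp_zero]
    exact congr_arg (fun l => l.hom) this
  have := mono_homology_map₂ hT (-1) (isZero_homology_stalk 0 (-1) (by simp) c.pt)
  exact ⟨_, hZ.2, (homologyStalkIso (-1) A).inv ≫ (homologyFunctor C (-1)).map g, mono_comp _ _⟩

/-- The stalk of a coproduct of torsion objects is also their coproduct in the heart, so compactness
of `V[0]` applies to it. -/
lemma IsTorsionPair.exists_finset_stalk (hV : heart T F ((singleFunctor C 0).obj V))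
    (hcomp : IsCompactObject.{t} (⟨_, hV⟩ : (heart T F).FullSubcategory))
    {I : Type t} {A : I → C} (hA : ∀ i, T (A i)) {c : Cofan A} (hc : IsColimit c)
    (f : V ⟶ c.pt) : ∃ s : Finset I, ∀ (Z : C) (_ : T Z) (g : c.pt ⟶ Z),
      (∀ i ∈ s, c.inj i ≫ g = 0) → f ≫ g = 0 := by
  have hc' := h.heart_stalk (h.torsion_coproduct hc hA)
  let X : I → (heart T F).FullSubcategory := fun i => ⟨_, h.heart_stalk (hA i)⟩
  let d : Cofan X := Cofan.mk (⟨_, hc'⟩ : (heart T F).FullSubcategory) fun i =>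
    ObjectProperty.homMk ((singleFunctor C 0).map (c.inj i))
  have hinj : ∀ i, d.inj i = ObjectProperty.homMk ((singleFunctor C 0).map (c.inj i)) :=
    fun i => rfl
  have key : ∀ s : Cofan X, ∃ g : (singleFunctor C 0).obj c.pt ⟶ s.pt.obj,
      ∀ i, (singleFunctor C 0).map (c.inj i) ≫ g = (s.inj i).hom := fun s => by
    have := s.pt.property.2.1
    exact exists_stalk_coproduct_desc hc (-1) _
  choose desc hdesc using key
  have hd : IsColimit d := Cofan.IsColimit.mk _ (fun s => ObjectProperty.homMk (desc s))
    (fun s i => by ext; exact hdesc s i) (fun s m hm => by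
      have := s.pt.property.2.1
      ext
      refine stalk_coproduct_hom_ext hc (-1) fun i => ?_
      exact (congr_arg (fun l => l.hom) (hm i)).trans (hdesc s i).symm)
  obtain ⟨x, hx⟩ := (hcomp I X d hd).2 (ObjectProperty.homMk ((singleFunctor C 0).map f))
  obtain ⟨s, hs⟩ := exists_finset_of_coproductComparison d x
  refine ⟨s, fun Z hZ g hg => (singleFunctor C 0).map_injective ?_⟩
  have := hs ⟨_, h.heart_stalk hZ⟩ (ObjectProperty.homMk ((singleFunctor C 0).map g)) fun i hi => by
    ext
    change (singleFunctor C 0).map (c.inj i) ≫ (singleFunctor C 0).map g = 0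
    rw [← Functor.map_comp, hg i hi, Functor.map_zero]
  rw [hx] at this
  rw [Functor.map_comp, Functor.map_zero]
  exact congr_arg (fun l => l.hom) this

lemma IsTorsionPair.exists_finset_stalk_shift (hV : heart T F ((singleFunctor C 0).obj V))
    (hcomp : IsCompactObject.{t} (⟨_, hV⟩ : (heart T F).FullSubcategory))
    {I : Type t} {A : I → C} (hA : ∀ i, F (A i)) {c : Cofan A} (hc : IsColimit c) (hcF : F c.pt)
    (f : (singleFunctor C 0).obj V ⟶ ((singleFunctor C 0).obj c.pt)⟦(1 : ℤ)⟧) :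
    ∃ s : Finset I, ∀ (Z : C) (_ : F Z) (g : c.pt ⟶ Z),
      (∀ i ∈ s, c.inj i ≫ g = 0) → f ≫ ((singleFunctor C 0).map g)⟦(1 : ℤ)⟧' = 0 := by
  let Ψ := singleFunctor C 0 ⋙ shiftFunctor (DerivedCategory C) (1 : ℤ)
  let X : I → (heart T F).FullSubcategory := fun i => ⟨_, h.heart_shift_stalk (hA i)⟩
  let d : Cofan X := Cofan.mk (⟨_, h.heart_shift_stalk hcF⟩ : (heart T F).FullSubcategory) fun i =>
    ObjectProperty.homMk (Ψ.map (c.inj i))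
  have key : ∀ s : Cofan X, ∃ g : Ψ.obj c.pt ⟶ s.pt.obj,
      (∀ i, Ψ.map (c.inj i) ≫ g = (s.inj i).hom) ∧
      ∀ g' : Ψ.obj c.pt ⟶ s.pt.obj, (∀ i, Ψ.map (c.inj i) ≫ g' = (s.inj i).hom) → g' = g := by
    intro s
    have := s.pt.property.2.1
    -- Shifting the target back by one turns maps out of shifted stalks into maps out of stalks in
    -- degree 0, for which the coproduct property is known.
    have : (s.pt.obj⟦(-1 : ℤ)⟧).IsGE 0 := TStructure.t.isGE_shift s.pt.obj (-1) (-1) 0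
    let e : s.pt.obj ≅ (s.pt.obj⟦(-1 : ℤ)⟧)⟦(1 : ℤ)⟧ :=
      ((shiftEquiv (DerivedCategory C) (1 : ℤ)).counitIso.app s.pt.obj).symm
    choose k hk using fun i => (shiftFunctor (DerivedCategory C) (1 : ℤ)).map_surjective
      (Y := s.pt.obj⟦(-1 : ℤ)⟧) ((s.inj i).hom ≫ e.hom)
    obtain ⟨l, hl⟩ := exists_stalk_coproduct_desc hc 0 k
    have hl' : ∀ i, Ψ.map (c.inj i) ≫ l⟦(1 : ℤ)⟧' = (s.inj i).hom ≫ e.hom := fun i => by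
      rw [← hk i, ← hl i, Functor.map_comp]; rfl
    refine ⟨l⟦(1 : ℤ)⟧' ≫ e.inv, fun i => ?_, fun g' hg' => ?_⟩
    · rw [← Category.assoc, hl', Category.assoc, e.hom_inv_id, Category.comp_id]
    · obtain ⟨l', hl''⟩ := (shiftFunctor (DerivedCategory C) (1 : ℤ)).map_surjective
        (Y := s.pt.obj⟦(-1 : ℤ)⟧) (g' ≫ e.hom)
      rw [← cancel_mono e.hom, Category.assoc, e.inv_hom_id, Category.comp_id, ← hl'']
      congr 1
      refine stalk_coproduct_hom_ext hc 0 fun i => ?_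
      apply (shiftFunctor (DerivedCategory C) (1 : ℤ)).map_injective
      rw [hl, hk, Functor.map_comp, hl'', ← hg' i, Category.assoc]
      rfl
  choose desc hdesc hdesc' using key
  have hd : IsColimit d := Cofan.IsColimit.mk _ (fun s => ObjectProperty.homMk (desc s))
    (fun s i => by ext; exact hdesc s i) (fun s m hm => by
      ext
      exact hdesc' s _ fun i => congr_arg (fun l => l.hom) (hm i))
  obtain ⟨x, hx⟩ := (hcomp I X d hd).2 (ObjectProperty.homMk f)
  obtain ⟨s, hs⟩ := exists_finset_of_coproductComparison d x
  refine ⟨s, fun Z hZ g hg => ?_⟩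
  have := hs ⟨_, h.heart_shift_stalk hZ⟩ (ObjectProperty.homMk (Ψ.map g)) fun i hi => by
    ext
    change Ψ.map (c.inj i) ≫ Ψ.map g = 0
    rw [← Functor.map_comp, hg i hi, Functor.map_zero]
  rw [hx] at this
  exact congr_arg (fun l => l.hom) this

end

section ShortExact

variable {A B D : C} {i : A ⟶ B} {p : B ⟶ D} {w : i ≫ p = 0}
  {δ : (singleFunctor C 0).obj D ⟶ ((singleFunctor C 0).obj A)⟦(1 : ℤ)⟧}
  (hT : Triangle.mk ((singleFunctor C 0).map i) ((singleFunctor C 0).map p) δ ∈ distTriang _)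
include hT

lemma exists_extension_of_comp_eq_zero {X : C} (f : A ⟶ X)
    (hf : δ ≫ ((singleFunctor C 0).map f)⟦(1 : ℤ)⟧' = 0) : ∃ g : B ⟶ X, i ≫ g = f := by
  obtain ⟨l, hl⟩ := exists_desc_of_triangle (rotate_triangle (rotate_triangle hT)) _ hf
  obtain ⟨l, rfl⟩ := (shiftFunctor (DerivedCategory C) (1 : ℤ)).map_surjective l
  obtain ⟨l, rfl⟩ := (singleFunctor C 0).map_surjective l
  refine ⟨-l, (singleFunctor C 0).map_injective
    ((shiftFunctor (DerivedCategory C) (1 : ℤ)).map_injective ?_)⟩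
  rw [hl]
  simp only [Functor.map_comp, Functor.map_neg, Preadditive.comp_neg, Preadditive.neg_comp]

lemma exists_lift_shift_of_comp_eq_zero {X : DerivedCategory C}
    (f : X ⟶ ((singleFunctor C 0).obj D)⟦(1 : ℤ)⟧) (hf : f ≫ δ⟦(1 : ℤ)⟧' = 0) :
    ∃ g : X ⟶ ((singleFunctor C 0).obj B)⟦(1 : ℤ)⟧,
      g ≫ ((singleFunctor C 0).map p)⟦(1 : ℤ)⟧' = f := by
  obtain ⟨l, hl⟩ := exists_lift_of_triangle₃
    (rotate_triangle (rotate_triangle (rotate_triangle hT))) f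
    (by rw [Preadditive.comp_neg, hf, neg_zero])
  exact ⟨-l, by rw [hl, Preadditive.neg_comp, Preadditive.comp_neg]⟩

end ShortExact

end ProgeneratorConsequences

/-! ### Directed systems of modules with zero colimit -/

section DirectedSystem

variable {R : Type u} [Ring R]

lemma cofan_induction {I : Type t} {X : I → ModuleCat.{u} R} {c : Cofan X} (hc : IsColimit c)
    {P : c.pt → Prop} (zero : P 0) (add : ∀ a b, P a → P b → P (a + b))
    (inj : ∀ i x, P (c.inj i x)) (y : c.pt) : P y := by
  classical
  let π : ∀ j, c.pt ⟶ X j := fun j => Cofan.IsColimit.desc hc fun i =>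
    if h : i = j then eqToHom (by rw [h]) else 0
  obtain ⟨s, hs⟩ := exists_sum_inj_eq hc π (fun j => by simp [π])
    (fun i j h => by simp [π, h]) y
  rw [← hs s subset_rfl]
  exact Finset.sum_induction _ P add zero fun i _ => inj i _

variable {ι : Type u} [SemilatticeSup ι] (M : ι ⥤ ModuleCat.{u} R)
  {c : Cofan M.obj} (hc : IsColimit c)
  {s : Cofan fun p : {p : ι × ι // p.1 ≤ p.2} => M.obj p.1.1} (hs : IsColimit s)

/-- The map `⨁_{i ≤ j} M i → ⨁ i, M i` whose cokernel is the colimit of `M`. -/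
def systemRelations (c : Cofan M.obj) : s.pt ⟶ c.pt :=
  Cofan.IsColimit.desc hs fun p => c.inj p.1.1 - M.map (homOfLE p.2) ≫ c.inj p.1.2

lemma inj_systemRelations (p : {p : ι × ι // p.1 ≤ p.2}) :
    s.inj p ≫ systemRelations M hs c = c.inj p.1.1 - M.map (homOfLE p.2) ≫ c.inj p.1.2 := by
  simp [systemRelations]

open scoped Classical in
/-- The map `⨁ i, M i → M k` given by the transition maps for `i ≤ k`, and by zero otherwise. -/
def systemProj (k : ι) : c.pt ⟶ M.obj k :=
  Cofan.IsColimit.desc hc fun i => if h : i ≤ k then M.map (homOfLE h) else 0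

lemma inj_systemProj {i k : ι} (h : i ≤ k) :
    c.inj i ≫ systemProj M hc k = M.map (homOfLE h) := by
  simp [systemProj, h]

lemma systemRelations_systemProj (p : {p : ι × ι // p.1 ≤ p.2}) {k : ι} (h : p.1.2 ≤ k) :
    s.inj p ≫ systemRelations M hs c ≫ systemProj M hc k = 0 := by
  rw [← Category.assoc, inj_systemRelations, Preadditive.sub_comp, Category.assoc,
    inj_systemProj M hc h, inj_systemProj M hc (p.2.trans h), ← Functor.map_comp]
  exact sub_self _

open scoped Classical in
/-- The map `⨁ i, M i → ⨁_{i ≤ j} M i` sending `M i` to the summand at `(i, k)` if `i ≤ k`. -/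
def systemSection (s : Cofan fun p : {p : ι × ι // p.1 ≤ p.2} => M.obj p.1.1) (k : ι) :
    c.pt ⟶ s.pt :=
  Cofan.IsColimit.desc hc fun i => if h : i ≤ k then s.inj ⟨(i, k), h⟩ else 0

lemma inj_systemSection {i k : ι} (h : i ≤ k) :
    c.inj i ≫ systemSection M hc s k = s.inj ⟨(i, k), h⟩ := by
  simp [systemSection, h]

include hc in
lemma systemRelations_surjective
    (hM : ∀ i (x : M.obj i), ∃ (k : ι) (h : i ≤ k), M.map (homOfLE h) x = 0) :
    Function.Surjective (systemRelations M hs c) := by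
  intro y
  induction y using cofan_induction hc with
  | zero => exact ⟨0, map_zero _⟩
  | add a b ha hb =>
    obtain ⟨a, rfl⟩ := ha
    obtain ⟨b, rfl⟩ := hb
    exact ⟨a + b, map_add _ _ _⟩
  | inj i x =>
    obtain ⟨k, h, hx⟩ := hM i x
    -- The relation at `(i, k)` sends `x` to `x` minus its image in `M k`, which is zero.
    refine ⟨s.inj ⟨(i, k), h⟩ x, ?_⟩
    rw [← ConcreteCategory.comp_apply, inj_systemRelations]
    simp [hx]

variable {r : Cofan fun q : {q : ι × ι × ι // q.1 ≤ q.2.1 ∧ q.2.1 ≤ q.2.2} => M.obj q.1.1}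
  (hr : IsColimit r)

/-- The map `⨁_{i ≤ j ≤ k} M i → ⨁_{i ≤ j} M i` whose image is the kernel of
`systemRelations`. -/
def systemSyzygies (s : Cofan fun p : {p : ι × ι // p.1 ≤ p.2} => M.obj p.1.1) : r.pt ⟶ s.pt :=
  Cofan.IsColimit.desc hr fun q => s.inj ⟨(q.1.1, q.1.2.1), q.2.1⟩ +
    M.map (homOfLE q.2.1) ≫ s.inj ⟨(q.1.2.1, q.1.2.2), q.2.2⟩ -
    s.inj ⟨(q.1.1, q.1.2.2), q.2.1.trans q.2.2⟩

lemma inj_systemSyzygies (q : {q : ι × ι × ι // q.1 ≤ q.2.1 ∧ q.2.1 ≤ q.2.2}) :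
    r.inj q ≫ systemSyzygies M hr s = s.inj ⟨(q.1.1, q.1.2.1), q.2.1⟩ +
      M.map (homOfLE q.2.1) ≫ s.inj ⟨(q.1.2.1, q.1.2.2), q.2.2⟩ -
      s.inj ⟨(q.1.1, q.1.2.2), q.2.1.trans q.2.2⟩ := by
  simp [systemSyzygies]

lemma systemSyzygies_comp : systemSyzygies M hr s ≫ systemRelations M hs c = 0 := by
  refine Cofan.IsColimit.hom_ext hr _ _ fun q => ?_
  rw [← Category.assoc, inj_systemSyzygies, Preadditive.sub_comp, Preadditive.add_comp,
    Category.assoc]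
  simp only [inj_systemRelations, comp_zero, Preadditive.comp_sub, ← Category.assoc,
    ← Functor.map_comp, homOfLE_comp]
  abel

/-- `systemSection` is a contracting homotopy of the bar complex on the indices below `k`: appending
`k` to the pair `(i, j)` gives the triple `(i, j, k)` that witnesses the identity. A given `y`
involves only finitely many indices, so one `k` suffices. -/
lemma exists_systemSyzygies_eq [OrderBot ι] (y : s.pt) : ∃ k₀, ∀ k, k₀ ≤ k →
    ∃ z, systemSyzygies M hr s z = y - systemSection M hc s k (systemRelations M hs c y) := by
  induction y using cofan_induction hs with
  | zero => exact ⟨⊥, fun k _ => ⟨0, by simp⟩⟩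
  | add a b ha hb =>
    obtain ⟨k, ha⟩ := ha
    obtain ⟨l, hb⟩ := hb
    refine ⟨k ⊔ l, fun m hm => ?_⟩
    obtain ⟨x, hx⟩ := ha m (le_sup_left.trans hm)
    obtain ⟨y, hy⟩ := hb m (le_sup_right.trans hm)
    refine ⟨x + y, ?_⟩
    simp only [map_add, hx, hy]
    abel
  | inj p x =>
    refine ⟨p.1.2, fun k hk => ⟨r.inj ⟨(p.1.1, p.1.2, k), p.2, hk⟩ x, ?_⟩⟩
    have hp : s.inj p ≫ systemRelations M hs c ≫ systemSection M hc s k =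
        s.inj ⟨(p.1.1, k), p.2.trans hk⟩ - M.map (homOfLE p.2) ≫ s.inj ⟨(p.1.2, k), hk⟩ := by
      rw [← Category.assoc, inj_systemRelations, Preadditive.sub_comp, Category.assoc,
        inj_systemSection M hc hk, inj_systemSection M hc (p.2.trans hk)]
    simp only [← ConcreteCategory.comp_apply, inj_systemSyzygies, Category.assoc, hp]
    simp
    abel

include hc in
lemma exists_systemSyzygies_eq_of_mem_ker [OrderBot ι] (y : s.pt)
    (hy : systemRelations M hs c y = 0) : ∃ z, systemSyzygies M hr s z = y := by
  obtain ⟨k, hk⟩ := exists_systemSyzygies_eq M hc hs hr y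
  obtain ⟨z, hz⟩ := hk k le_rfl
  exact ⟨z, by rw [hz, hy, map_zero, sub_zero]⟩

end DirectedSystem

/-! ### Finite presentation of `V` from compactness -/

section FinitePresentation

variable {R : Type u} [Ring R]

/-- The directed system of the quotients of a module by an increasing family of submodules. -/
def quotientSystem {ι : Type u} [Preorder ι] {K : Type u} [AddCommGroup K] [Module R K]
    (N : ι →o Submodule R K) : ι ⥤ ModuleCat.{u} R where
  obj i := ModuleCat.of R (K ⧸ N i)
  map f := ModuleCat.ofHom (Submodule.factor (N.monotone f.le))
  map_id i := by ext x; simp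
  map_comp f g := by ext x; simp

section

variable {ι : Type u} [SemilatticeSup ι]

lemma exists_quotientSystem_map_eq_zero {K : Type u} [AddCommGroup K] [Module R K]
    (N : ι →o Submodule R K) (hN : ∀ x, ∃ i, x ∈ N i) (i : ι) (x : (quotientSystem N).obj i) :
    ∃ (k : ι) (h : i ≤ k), (quotientSystem N).map (homOfLE h) x = 0 := by
  obtain ⟨x, rfl⟩ := Submodule.mkQ_surjective _ x
  obtain ⟨j, hj⟩ := hN x
  exact ⟨i ⊔ j, le_sup_left, (Submodule.Quotient.mk_eq_zero _).2 (N.monotone le_sup_right hj)⟩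

lemma exists_comp_map_eq_zero (M : ι ⥤ ModuleCat.{u} R)
    (hM : ∀ i (x : M.obj i), ∃ (k : ι) (h : i ≤ k), M.map (homOfLE h) x = 0)
    {B : ModuleCat.{u} R} [Module.Finite R B] {i : ι} (f : B ⟶ M.obj i) :
    ∃ (k : ι) (h : i ≤ k), f ≫ M.map (homOfLE h) = 0 := by
  classical
  obtain ⟨S, hS⟩ := (Module.finite_def (R := R) (M := B)).1 inferInstance
  have key : ∃ (k : ι) (h : i ≤ k), ∀ x ∈ S, M.map (homOfLE h) (f x) = 0 := by
    clear hS
    induction S using Finset.induction_on with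
    | empty => exact ⟨i, le_rfl, by simp⟩
    | insert a S _ ih =>
      obtain ⟨k, h, hk⟩ := ih
      obtain ⟨l, h', hl⟩ := hM i (f a)
      have hm : ∀ {j} (hij : i ≤ j) (hj : j ≤ k ⊔ l) (y : M.obj i), M.map (homOfLE hij) y = 0 →
          M.map (homOfLE (hij.trans hj)) y = 0 := fun hij hj y hy => by
        rw [← homOfLE_comp hij hj, Functor.map_comp, ConcreteCategory.comp_apply, hy, map_zero]
      refine ⟨k ⊔ l, h.trans le_sup_left, fun x hx => ?_⟩
      rcases Finset.mem_insert.1 hx with rfl | hx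
      · exact hm h' le_sup_right _ hl
      · exact hm h le_sup_left _ (hk x hx)
  obtain ⟨k, h, hk⟩ := key
  refine ⟨k, h, ?_⟩
  ext x
  have hx : x ∈ Submodule.span R (S : Set B) := hS ▸ Submodule.mem_top
  change (f ≫ M.map (homOfLE h)) x = 0
  induction hx using Submodule.span_induction with
  | mem x hx => exact hk x hx
  | zero => simp
  | add x y _ _ hx hy => rw [map_add, hx, hy, add_zero]
  | smul r x _ hx => rw [map_smul, hx, smul_zero]

end

/-- The submodules generated by the finite subsets of a module. -/
def finsetSpan (K : Type u) [AddCommGroup K] [Module R K] : Finset K →o Submodule R K where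
  toFun s := Submodule.span R s
  monotone' _ _ h := Submodule.span_mono h

lemma exists_mem_finsetSpan {K : Type u} [AddCommGroup K] [Module R K] (x : K) :
    ∃ s, x ∈ finsetSpan (R := R) K s :=
  ⟨{x}, Submodule.subset_span (by simp)⟩

/-- The common kernel of the homomorphisms to modules of `F` which vanish on a finite set. -/
def finsetClosure (F : ObjectProperty (ModuleCat.{u} R)) (K : Type u) [AddCommGroup K]
    [Module R K] : Finset K →o Submodule R K where
  toFun s :=
    { carrier := {x | ∀ (B : ModuleCat.{u} R), F B → ∀ f : K →ₗ[R] B, (∀ y ∈ s, f y = 0) → f x = 0}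
      zero_mem' := fun B _ f _ => map_zero f
      add_mem' := fun ha hb B hB f hf => by rw [map_add, ha B hB f hf, hb B hB f hf, add_zero]
      smul_mem' := fun r a ha B hB f hf => by rw [map_smul, ha B hB f hf, smul_zero] }
  monotone' _ _ h _ hx B hB f hf := hx B hB f fun y hy => hf y (h hy)

lemma subset_finsetClosure (F : ObjectProperty (ModuleCat.{u} R)) {K : Type u} [AddCommGroup K]
    [Module R K] (s : Finset K) : finsetSpan K s ≤ finsetClosure F K s :=
  Submodule.span_le.2 fun x hx _ _ _ hf => hf x hx

/-- The closure of `s` is the preimage in `K` of the torsion part of `K / span s`, since every map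
from that quotient to a torsion-free module factors through its torsion-free quotient. So `K` modulo
the closure is torsion-free, and if the closure is all of `K` then `K / span s` is torsion. -/
lemma IsTorsionPair.exists_finsetClosure_eq {T F : ObjectProperty (ModuleCat.{u} R)}
    (h : IsTorsionPair T F) {K : Type u} [AddCommGroup K] [Module R K] (s : Finset K) :
    ∃ (A B : ModuleCat.{u} R) (_ : T A) (_ : F B) (i : A ⟶ (quotientSystem (finsetSpan K)).obj s)
      (p : (quotientSystem (finsetSpan K)).obj s ⟶ B) (w : i ≫ p = 0),
      (ShortComplex.mk i p w).ShortExact ∧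
        finsetClosure F K s = LinearMap.ker (p.hom ∘ₗ (finsetSpan K s).mkQ) := by
  obtain ⟨A, B, hA, hB, i, p, w, hS⟩ :=
    h.exists_shortExact ((quotientSystem (finsetSpan (R := R) K)).obj s)
  refine ⟨A, B, hA, hB, i, p, w, hS, le_antisymm (fun x hx => ?_) fun x hx D hD f hf => ?_⟩
  · refine hx B hB (p.hom ∘ₗ (finsetSpan K s).mkQ) fun y hy => ?_
    have : (finsetSpan (R := R) K s).mkQ y = 0 :=
      (Submodule.Quotient.mk_eq_zero _).2 (Submodule.subset_span hy)
    exact (congr_arg p.hom this).trans (map_zero _)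
  · have := hS.epi_g
    let g : (quotientSystem (finsetSpan (R := R) K)).obj s ⟶ D :=
      ModuleCat.ofHom ((finsetSpan K s).liftQ f (Submodule.span_le.2 hf))
    obtain ⟨l, hl⟩ := hS.exact.desc' (A := D) g (h.hom_eq_zero hA hD _)
    have h1 : g ((finsetSpan K s).mkQ x) = f x := rfl
    rw [← h1, ← hl]
    have h2 : p ((finsetSpan K s).mkQ x) = 0 := hx
    change l (p _) = 0
    rw [h2, map_zero]

lemma IsTorsionPair.torsionFree_quotientSystem {T F : ObjectProperty (ModuleCat.{u} R)}
    [F.IsClosedUnderIsomorphisms] (h : IsTorsionPair T F) {K : Type u} [AddCommGroup K]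
    [Module R K] (s : Finset K) : F ((quotientSystem (finsetClosure F K)).obj s) := by
  obtain ⟨A, B, hA, hB, i, p, w, hS, hN⟩ := h.exists_finsetClosure_eq s
  let j : (quotientSystem (finsetClosure F K)).obj s ⟶ B :=
    ModuleCat.ofHom ((finsetClosure F K s).liftQ (p.hom ∘ₗ (finsetSpan K s).mkQ) hN.le)
  have : Mono j := by
    rw [ModuleCat.mono_iff_ker_eq_bot]
    exact Submodule.ker_liftQ_eq_bot _ _ _ hN.ge
  exact h.torsionFree_of_mono j hB

lemma IsTorsionPair.torsion_of_finsetClosure_eq_top {T F : ObjectProperty (ModuleCat.{u} R)}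
    [T.IsClosedUnderIsomorphisms] (h : IsTorsionPair T F) {K : Type u} [AddCommGroup K]
    [Module R K] (s : Finset K) (hs : finsetClosure F K s = ⊤) :
    T ((quotientSystem (finsetSpan K)).obj s) := by
  obtain ⟨A, B, hA, hB, i, p, w, hS, hN⟩ := h.exists_finsetClosure_eq s
  have hp : p = 0 := by
    ext x
    obtain ⟨x, rfl⟩ := Submodule.mkQ_surjective _ x
    have : x ∈ LinearMap.ker (p.hom ∘ₗ (finsetSpan (R := R) K s).mkQ) := by rw [← hN, hs]; trivial
    exact this
  have : Epi i := hS.exact.epi_f hp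
  exact h.torsion_of_epi i hA

variable {V : ModuleCat.{u} R} [HasDerivedCategory.{w} (ModuleCat.{u} R)]
  (h : IsTorsionPair (gen V) (kerHom V))
  (hV : heart (gen V) (kerHom V) ((singleFunctor (ModuleCat.{u} R) 0).obj V))
  (P : IsProgenerator.{u} (⟨_, hV⟩ : (heart (gen V) (kerHom V)).FullSubcategory))

include h P

/-- The quotients of `V` by finitely generated submodules form a system with zero colimit.
Compactness shows that the canonical map from `V` to one of these quotients is already zero. -/
lemma finite_of_isProgenerator : Module.Finite R V := by
  classical
  let M := quotientSystem (finsetSpan (R := R) V)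
  have hM := exists_quotientSystem_map_eq_zero (finsetSpan (R := R) V) exists_mem_finsetSpan
  let q : ∀ s, V ⟶ M.obj s := fun s => ModuleCat.ofHom (finsetSpan V s).mkQ
  have hq : ∀ s, Epi (q s) := fun s => by
    rw [ModuleCat.epi_iff_surjective]
    exact Submodule.mkQ_surjective _
  have hgen : ∀ s, gen V (M.obj s) := fun s => gen_of_epi (q s) (gen_self V)
  let c : Cofan M.obj := Cofan.mk _ (Sigma.ι _)
  have hc : IsColimit c := coproductIsCoproduct _
  let s : Cofan fun p : {p : Finset V × Finset V // p.1 ≤ p.2} => M.obj p.1.1 :=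
    Cofan.mk _ (Sigma.ι _)
  have hs : IsColimit s := coproductIsCoproduct _
  let r : Cofan fun q : {q : Finset V × Finset V × Finset V // q.1 ≤ q.2.1 ∧ q.2.1 ≤ q.2.2} =>
    M.obj q.1.1 := Cofan.mk _ (Sigma.ι _)
  have hr : IsColimit r := coproductIsCoproduct _
  let d := systemRelations M hs c
  have : Epi d := by
    rw [ModuleCat.epi_iff_surjective]
    exact systemRelations_surjective M hc hs hM
  have hS : (ShortComplex.mk (kernel.ι d) d (kernel.condition d)).ShortExact :=
    { exact := ShortComplex.exact_kernel d }
  have hex : (ShortComplex.mk (systemSyzygies M hr s) d (systemSyzygies_comp M hs hr)).Exact := by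
    rw [ShortComplex.moduleCat_exact_iff]
    exact exists_systemSyzygies_eq_of_mem_ker M hc hs hr
  have : Epi (kernel.lift d (systemSyzygies M hr s) (systemSyzygies_comp M hs hr)) :=
    hex.epi_kernelLift
  -- The kernel is covered by the sum over triples, so it is torsion and `Ext^1(V, kernel d)`
  -- vanishes. The map from `V` into the summand at `⊥` therefore lifts along `d`.
  have hker : gen V (kernel d) :=
    gen_of_epi (kernel.lift d _ (systemSyzygies_comp M hs hr))
      (h.torsion_coproduct hr fun _ => hgen _)
  obtain ⟨g, hg⟩ := exists_lift_of_kerExt hS (h.kerExt_one hV P.projective hker) (q ⊥ ≫ c.inj ⊥)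
  obtain ⟨S, hS⟩ := h.exists_finset_stalk hV P.compact (fun _ => hgen _) hs g
  -- At such a `k` the projection to `M k` kills the relations indexed by `S`, so compactness turns
  -- the lift into the vanishing of `V → M k`.
  let k := S.sup fun p => p.1.2
  have key := hS _ (hgen k) (d ≫ systemProj M hc k)
    fun p hp => systemRelations_systemProj M hc hs p (Finset.le_sup (f := fun p => p.1.2) hp)
  rw [← Category.assoc, hg, Category.assoc, inj_systemProj M hc bot_le] at key
  refine ⟨k, ?_⟩
  rw [eq_top_iff]
  intro x _
  exact (Submodule.Quotient.mk_eq_zero _).1 (congr_arg (fun l => l.hom x) key)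

lemma finitePresentation_of_isProgenerator : Module.FinitePresentation R V := by
  classical
  have := finite_of_isProgenerator h hV P
  obtain ⟨n, φ, hφ⟩ := Module.Finite.exists_fin' R V
  refine Module.finitePresentation_of_surjective φ hφ ?_
  let K := LinearMap.ker φ
  let i : ModuleCat.of R K ⟶ ModuleCat.of R (Fin n → R) := ModuleCat.ofHom K.subtype
  let p : ModuleCat.of R (Fin n → R) ⟶ V := ModuleCat.ofHom φ
  have w : i ≫ p = 0 := by ext x; exact x.2
  have hS : (ShortComplex.mk i p w).ShortExact :=
    { exact := by
        rw [ShortComplex.moduleCat_exact_iff]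
        exact fun x hx => ⟨⟨x, hx⟩, rfl⟩
      mono_f := (ModuleCat.mono_iff_injective _).2 Subtype.val_injective
      epi_g := (ModuleCat.epi_iff_surjective _).2 hφ }
  obtain ⟨δ, hδ⟩ := exists_stalk_triangle hS
  -- Closures rather than spans, to keep the quotients torsion-free. As `V` is finitely generated,
  -- their coproducts stay torsion-free too, so the class `δ` can be lifted along `d` by `Ext^2(V,
  -- kernel d) = 0`.
  let N := finsetClosure (kerHom V) K
  let M := quotientSystem N
  have hM := exists_quotientSystem_map_eq_zero N fun x => by
    obtain ⟨s, hs⟩ := exists_mem_finsetSpan (R := R) x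
    exact ⟨s, subset_finsetClosure _ s hs⟩
  have hF : ∀ s, kerHom V (M.obj s) := fun s => h.torsionFree_quotientSystem s
  have hcop : ∀ {I : Type u} {A : I → ModuleCat.{u} R} {c : Cofan A} (_ : IsColimit c),
      (∀ i, kerHom V (A i)) → kerHom V c.pt := fun hc hA f => by
    obtain ⟨x, rfl⟩ := coproductComparison_surjective V hc f
    induction x using DirectSum.induction_on with
    | zero => simp
    | of i f => rw [coproductComparison_of, hA i f, zero_comp]
    | add x y hx hy => rw [map_add, hx, hy, add_zero]
  let c : Cofan M.obj := Cofan.mk _ (Sigma.ι _)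
  have hc : IsColimit c := coproductIsCoproduct _
  let s : Cofan fun p : {p : Finset K × Finset K // p.1 ≤ p.2} => M.obj p.1.1 :=
    Cofan.mk _ (Sigma.ι _)
  have hs : IsColimit s := coproductIsCoproduct _
  let d := systemRelations M hs c
  have : Epi d := by
    rw [ModuleCat.epi_iff_surjective]
    exact systemRelations_surjective M hc hs hM
  have hS' : (ShortComplex.mk (kernel.ι d) d (kernel.condition d)).ShortExact :=
    { exact := ShortComplex.exact_kernel d }
  have hsF : kerHom V s.pt := hcop hs fun _ => hF _
  obtain ⟨ε, hε⟩ := exists_stalk_triangle hS'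
  let q : ∀ s, ModuleCat.of R K ⟶ M.obj s := fun s => ModuleCat.ofHom (N s).mkQ
  obtain ⟨g, hg⟩ := exists_lift_shift_of_comp_eq_zero hε
    (δ ≫ ((singleFunctor _ 0).map (q ⊥ ≫ c.inj ⊥))⟦(1 : ℤ)⟧')
    (h.hom_shift_eq_zero hV P.projective
      (h.heart_shift_stalk (h.torsionFree_of_mono (kernel.ι d) hsF)) _)
  obtain ⟨S, hS⟩ := h.exists_finset_stalk_shift hV P.compact (fun _ => hF _) hs hsF g
  let k := S.sup fun p => p.1.2
  have key := hS _ (hF k) (d ≫ systemProj M hc k)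
    fun p hp => systemRelations_systemProj M hc hs p (Finset.le_sup (f := fun p => p.1.2) hp)
  rw [Functor.map_comp, Functor.map_comp, ← Category.assoc, hg, Category.assoc,
    ← Functor.map_comp, ← Functor.map_comp, Category.assoc, inj_systemProj M hc bot_le] at key
  -- The pushed-out extension class vanishes at stage `k`, so `K → M k` extends to `R^n`. Since
  -- `R^n` is finitely generated the extension dies at a later stage `k'`, whence the closure of
  -- `k'` is all of `K`.
  obtain ⟨e, he⟩ := exists_extension_of_comp_eq_zero hδ _ key
  obtain ⟨k', hk', hk''⟩ := exists_comp_map_eq_zero M hM e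
  have hN : N k' = ⊤ := by
    rw [eq_top_iff]
    intro x _
    refine (Submodule.Quotient.mk_eq_zero _).1 ?_
    have := congr_arg (fun l => i ≫ l) hk''
    rw [comp_zero, ← Category.assoc, he] at this
    exact congr_arg (fun l => l.hom x) this
  have hT := h.torsion_of_finsetClosure_eq_top k' hN
  let q' : ∀ s, ModuleCat.of R K ⟶ (quotientSystem (finsetSpan K)).obj s :=
    fun s => ModuleCat.ofHom (finsetSpan K s).mkQ
  -- Now `K / span k'` is torsion, so `Ext^1` vanishing extends `K → K / span k'` to `R^n`. This
  -- extension dies at some `l`, which therefore spans `K`.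
  obtain ⟨e, he⟩ := exists_extension_of_comp_eq_zero hδ (q' k')
    (h.hom_shift_eq_zero hV P.projective (h.heart_stalk hT) _)
  obtain ⟨l, hl, hl'⟩ := exists_comp_map_eq_zero _
    (exists_quotientSystem_map_eq_zero (finsetSpan (R := R) K) exists_mem_finsetSpan) e
  rw [← Submodule.fg_top]
  refine ⟨l, ?_⟩
  rw [eq_top_iff]
  intro x _
  refine (Submodule.Quotient.mk_eq_zero _).1 ?_
  have := congr_arg (fun l => i ≫ l) hl'
  rw [comp_zero, ← Category.assoc, he] at this
  exact congr_arg (fun l => l.hom x) this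

omit h P in
theorem StalkIsProgenerator.isStalkProgeneratorModule (h : StalkIsProgenerator V) :
    IsStalkProgeneratorModule V := by
  obtain ⟨h, hV, P⟩ := h
  have hTV : pres V V :=
    (pres V).prop_of_iso (homologyStalkIso 0 V) hV.1.2
  have hpg : pres V = gen V := le_antisymm pres_le_gen fun X hX => by
    obtain ⟨I, c, hc, p, _⟩ := hX
    exact h.torsion_of_epi p (h.torsion_coproduct hc fun _ => hTV)
  have hemb := fun F (hF : kerHom V F) => h.exists_mono_torsion hTV hV P.generator hF
  rw [hpg] at h
  -- The progenerator condition depends on the torsion class through the type of the heart; a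
  -- variable `T` allows substituting `pres V = gen V`.
  have aux : ∀ (T : ObjectProperty (ModuleCat.{u} R)), T = gen V →
      (∃ hV : heart T (kerHom V) ((singleFunctor (ModuleCat.{u} R) 0).obj V),
        IsProgenerator.{u} (⟨_, hV⟩ : (heart T (kerHom V)).FullSubcategory)) →
      ∃ hV : heart (gen V) (kerHom V) ((singleFunctor (ModuleCat.{u} R) 0).obj V),
        IsProgenerator.{u} (⟨_, hV⟩ : (heart (gen V) (kerHom V)).FullSubcategory) := by
    rintro _ rfl h
    exact h
  obtain ⟨hV, P⟩ := aux _ hpg ⟨hV, P⟩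
  exact
    { finitePresentation := finitePresentation_of_isProgenerator h hV P
      pres_eq_gen := hpg
      gen_le_kerExt_one := fun X hX => h.kerExt_one hV P.projective hX
      kerHom_le_kerExt_two := fun X hX => h.kerExt_two hV P.projective hX
      embeds := hemb }

end FinitePresentation

/-! ### The category of subgenerated modules is Grothendieck -/

section SubgenGrothendieck

variable {R : Type u} [Ring R] {V : ModuleCat.{u} R}

lemma subgen_coproduct (h : gen V ≤ kerExt 1 V) {I : Type u} (X : I → ModuleCat.{u} R)
    (hX : ∀ i, subgen V (X i)) : subgen V (∐ X) := by
  choose Y hY i hi using hX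
  refine ⟨∐ Y, (isTorsionPair_gen h).torsion_coproduct (coproductIsCoproduct Y) hY,
    Limits.Sigma.map i, ?_⟩
  exact inferInstance

lemma isClosedUnderColimitsOfShape_subgen (h : gen V ≤ kerExt 1 V) (J : Type u)
    [SmallCategory J] : (subgen V).IsClosedUnderColimitsOfShape J :=
  .mk' <| by
    rintro _ ⟨F, hF⟩
    have : Epi (Sigma.desc (colimit.ι F)) := ⟨fun f g hfg => by
      refine colimit.hom_ext fun j => ?_
      have := Sigma.ι F.obj j ≫= hfg
      simpa using this⟩
    exact (subgen V).prop_of_epi (Sigma.desc (colimit.ι F)) (subgen_coproduct h _ hF)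

lemma hasColimitsOfSize_subgen (h : gen V ≤ kerExt 1 V) :
    HasColimitsOfSize.{u, u} (Subgen V) where
  has_colimits_of_shape J _ := by
    have := isClosedUnderColimitsOfShape_subgen h J
    infer_instance

lemma preservesColimitsOfShape_incl (h : gen V ≤ kerExt 1 V) (J : Type u) [SmallCategory J] :
    PreservesColimitsOfShape J (Subgen.incl V) := by
  have := isClosedUnderColimitsOfShape_subgen h J
  infer_instance

/-- The cyclic modules `R / J` that are subgenerated form a small separating family: the cyclic
submodule generated by an element of a subgenerated module is one of them. -/
lemma hasSeparator_subgen (h : gen V ≤ kerExt 1 V) : HasSeparator (Subgen V) := by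
  have := hasColimitsOfSize_subgen h
  let β := {J : Submodule R R // subgen V (ModuleCat.of R (R ⧸ J))}
  let G : β → Subgen V := fun J => ⟨_, J.2⟩
  refine ⟨∐ G, (isSeparator_sigma G).2 fun X Y f g hfg => ?_⟩
  ext x
  let φ : R →ₗ[R] X.obj := LinearMap.toSpanSingleton R X.obj x
  let i : ModuleCat.of R (R ⧸ LinearMap.ker φ) ⟶ X.obj :=
    ModuleCat.ofHom ((LinearMap.ker φ).liftQ φ le_rfl)
  have : Mono i := by
    rw [ModuleCat.mono_iff_ker_eq_bot]
    exact Submodule.ker_liftQ_eq_bot _ _ _ le_rfl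
  let J : β := ⟨LinearMap.ker φ, (subgen V).prop_of_mono i X.property⟩
  have key := hfg (G J) ⟨J⟩ (ObjectProperty.homMk i)
  have h1 : i ((LinearMap.ker φ).mkQ 1) = x := one_smul R x
  have h2 := congr_arg (fun l => l.hom ((LinearMap.ker φ).mkQ 1)) key
  change f.hom (i _) = g.hom (i _) at h2
  rw [h1] at h2
  exact h2

lemma isGrothendieckAbelian_subgen (h : gen V ≤ kerExt 1 V) :
    IsGrothendieckAbelian.{u} (Subgen V) := by
  have := hasColimitsOfSize_subgen h
  have : HasFilteredColimitsOfSize.{u, u} (Subgen V) := ⟨fun J _ _ => inferInstance⟩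
  have : ReflectsFiniteLimits (Subgen.incl V) :=
    ⟨fun J _ _ => inferInstance⟩
  have := hasSeparator_subgen h
  exact
    { ab5OfSize := ⟨fun J _ _ => by
        have := preservesColimitsOfShape_incl h J
        exact HasExactColimitsOfShape.domain_of_functor J (Subgen.incl V)⟩ }

end SubgenGrothendieck

/-! ### `V` is classical 1-tilting among subgenerated modules -/

section SubgenTilting

variable {R : Type u} [Ring R] {V : ModuleCat.{u} R}

lemma shortExact_incl {A B D : Subgen V} {i : A ⟶ B} {p : B ⟶ D} {w : i ≫ p = 0}
    (hS : (ShortComplex.mk i p w).ShortExact) :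
    (ShortComplex.mk i.hom p.hom (congr_arg (fun l => l.hom) w)).ShortExact :=
  hS.map_of_exact (Subgen.incl V)

lemma shortExact_of_incl {A B D : Subgen V} {i : A ⟶ B} {p : B ⟶ D} {w : i ≫ p = 0}
    (hS : (ShortComplex.mk i.hom p.hom (congr_arg (fun l => l.hom) w)).ShortExact) :
    (ShortComplex.mk i p w).ShortExact where
  exact := ((ShortComplex.mk i p w).exact_map_iff_of_faithful (Subgen.incl V)).1 hS.exact
  mono_f := (Subgen.incl V).mono_of_mono_map hS.mono_f
  epi_g := (Subgen.incl V).epi_of_epi_map hS.epi_g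

/-- Coproducts of copies of `V` and epimorphisms are the same in both categories. -/
lemma gen_subgenSelf_iff (h : gen V ≤ kerExt 1 V) (X : Subgen V) :
    gen (Subgen.self V) X ↔ gen V X.obj := by
  constructor
  · rintro ⟨I, c, hc, p, _⟩
    have := preservesColimitsOfShape_incl h (Discrete I)
    have hp : Epi p.hom := inferInstanceAs (Epi ((Subgen.incl V).map p))
    let d : Cofan fun _ : I => V := Cofan.mk c.pt.obj fun i => (c.inj i).hom
    have hd : IsColimit d := isColimitCofanMkObjOfIsColimit (Subgen.incl V) _ _ hc
    exact ⟨I, d, hd, p.hom, hp⟩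
  · rintro ⟨I, c, hc, p, hp⟩
    let d : Cofan fun _ : I => Subgen.self V := Cofan.mk
      ⟨c.pt, gen_le_subgen _ ⟨I, c, hc, 𝟙 _, inferInstance⟩⟩ fun i => ObjectProperty.homMk (c.inj i)
    refine ⟨I, d, Cofan.IsColimit.mk _
      (fun s => ObjectProperty.homMk (Cofan.IsColimit.desc hc fun i => (s.inj i).hom))
      (fun s i => by ext : 1; exact Cofan.IsColimit.fac hc _ i)
      (fun s m hm => ?_), ObjectProperty.homMk p, (Subgen.incl V).epi_of_epi_map hp⟩
    ext : 1
    refine Cofan.IsColimit.hom_ext hc _ _ fun i => ?_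
    exact (congr_arg (fun l => l.hom) (hm i)).trans
      (Cofan.IsColimit.fac hc (fun i => (s.inj i).hom) i).symm

lemma kerHom_subgenSelf_iff (X : Subgen V) : kerHom (Subgen.self V) X ↔ kerHom V X.obj :=
  ⟨fun hX f => congr_arg (fun l => l.hom) (hX (ObjectProperty.homMk f)), fun hX f => by
    ext : 1
    exact hX f.hom⟩

lemma torsionIn_eq (h : gen V ≤ kerExt 1 V) (h' : pres V = gen V) :
    torsionIn V = gen (Subgen.self V) := by
  ext X
  rw [torsionIn, h', gen_subgenSelf_iff h]
  rfl

lemma torsionFreeIn_eq : torsionFreeIn V = kerHom (Subgen.self V) := by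
  ext X
  rw [kerHom_subgenSelf_iff]
  rfl

/-- Present `Y/X` as `V^(I)` modulo `K` with `K` in `Gen V`, and lift `V^(I) → Y/X` to `l : V^(I) →
Y`. Then `K` maps to `X` and `X` maps onto `coker l`, a quotient of `Y`, with exactness in the
middle; so `X` is an extension of members of the torsion class `Gen V`. -/
lemma gen_of_mono (h : IsWeakTilting V) {X Y : ModuleCat.{u} R} (hY : gen V Y) (i : X ⟶ Y) [Mono i]
    (hlift : ∀ f : V ⟶ cokernel i, ∃ g : V ⟶ Y, g ≫ cokernel.π i = f) : gen V X := by
  have hZ : pres V (cokernel i) := h.pres_eq_gen ▸ gen_of_epi (cokernel.π i) hY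
  obtain ⟨I, c, hc, K, hK, j, p, w, hS⟩ := exists_shortExact_of_pres hZ
  have hS' : (ShortComplex.mk i (cokernel.π i) (by simp)).ShortExact :=
    { exact := ShortComplex.exact_cokernel _ }
  choose g hg using fun a => hlift (c.inj a ≫ p)
  let l : c.pt ⟶ Y := Cofan.IsColimit.desc hc g
  have hl : l ≫ cokernel.π i = p := Cofan.IsColimit.hom_ext hc _ _ fun a => by simp [l, hg]
  obtain ⟨k, hk⟩ := hS'.exact.lift' (j ≫ l) (by
    change (j ≫ l) ≫ cokernel.π i = 0
    rw [Category.assoc, hl, w])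
  change k ≫ i = j ≫ l at hk
  have hi : Function.Injective i := (ModuleCat.mono_iff_injective i).1 inferInstance
  have hpl : ∀ v, cokernel.π i (l v) = p v := fun v => by rw [← hl]; rfl
  have hex := (ShortComplex.moduleCat_exact_iff _).1 hS'.exact
  have hw : k ≫ i ≫ cokernel.π l = 0 := by
    rw [← Category.assoc, hk, Category.assoc, cokernel.condition, comp_zero]
  refine (isTorsionPair_gen h.gen_le_kerExt_one).torsion_of_exact
    (S := ShortComplex.mk k (i ≫ cokernel.π l) hw) ?_ ?_ hK (gen_of_epi (cokernel.π l) hY)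
  · rw [ShortComplex.moduleCat_exact_iff]
    intro x hx
    have hS'' : (ShortComplex.mk l (cokernel.π l) (by simp)).Exact :=
      ShortComplex.exact_cokernel _
    obtain ⟨v, hv⟩ := (ShortComplex.moduleCat_exact_iff _).1 hS'' (i x) hx
    change l v = i x at hv
    obtain ⟨y, hy⟩ := (ShortComplex.moduleCat_exact_iff _).1 hS.exact v (by
      change p v = 0
      rw [← hpl, hv, ← ConcreteCategory.comp_apply, cokernel.condition]
      rfl)
    change j y = v at hy
    refine ⟨y, hi ?_⟩
    change i (k y) = i x
    rw [← ConcreteCategory.comp_apply k, hk, ConcreteCategory.comp_apply, hy, hv]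
  · rw [ModuleCat.epi_iff_surjective]
    intro z
    obtain ⟨y, rfl⟩ := (ModuleCat.epi_iff_surjective (cokernel.π l)).1 inferInstance z
    obtain ⟨v, hv⟩ := (ModuleCat.epi_iff_surjective p).1 hS.epi_g (cokernel.π i y)
    obtain ⟨x, hx⟩ := hex (y - l v) (by
      change cokernel.π i (y - l v) = 0
      rw [map_sub, hpl, hv, sub_self])
    change i x = y - l v at hx
    refine ⟨x, ?_⟩
    change cokernel.π l (i x) = _
    rw [hx, map_sub, ← ConcreteCategory.comp_apply l, cokernel.condition]
    simp

/-- Both inclusions reduce Ext in the subcategory to lifting maps from `V`: along an injective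
embedding of `X` in the subcategory, where `Ext^1` over `R` provides the lifts, and along an
embedding of `X` in `Gen V`, which feeds `gen_of_mono`. -/
lemma IsWeakTilting.gen_subgenSelf_eq (h : IsWeakTilting V) :
    gen (Subgen.self V) = kerExt 1 (Subgen.self V) := by
  have := isGrothendieckAbelian_subgen h.gen_le_kerExt_one
  ext X
  rw [gen_subgenSelf_iff h.gen_le_kerExt_one]
  constructor
  · intro hX
    have hS : (ShortComplex.mk (Injective.ι X) (cokernel.π (Injective.ι X)) (by simp)).ShortExact :=
      { exact := ShortComplex.exact_cokernel _ }
    refine kerExt_one_of_lift hS (kerExt_of_injective 0 _) fun f => ?_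
    obtain ⟨g, hg⟩ := exists_lift_of_kerExt (shortExact_incl hS) (h.gen_le_kerExt_one _ hX) f.hom
    exact ⟨ObjectProperty.homMk g, by ext : 1; exact hg⟩
  · intro hX
    obtain ⟨Y, hY, i, _⟩ := X.property
    refine gen_of_mono h hY i fun f => ?_
    let Y' : Subgen V := ⟨Y, gen_le_subgen _ hY⟩
    let Z' : Subgen V := ⟨cokernel i, (subgen V).prop_of_epi (cokernel.π i) Y'.property⟩
    let i' : X ⟶ Y' := ObjectProperty.homMk i
    let p' : Y' ⟶ Z' := ObjectProperty.homMk (cokernel.π i)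
    have w : i' ≫ p' = 0 := by ext : 1; exact cokernel.condition i
    have hS : (ShortComplex.mk i' p' w).ShortExact := shortExact_of_incl
      { exact := ShortComplex.exact_cokernel i
        mono_f := by assumption
        epi_g := inferInstanceAs (Epi (cokernel.π i)) }
    obtain ⟨g, hg⟩ := exists_lift_of_kerExt hS hX (ObjectProperty.homMk f : Subgen.self V ⟶ Z')
    exact ⟨g.hom, congr_arg (fun l => l.hom) hg⟩

lemma isSelfSmall_subgenSelf (h : gen V ≤ kerExt 1 V) [Module.Finite R V] :
    IsSelfSmall (Subgen.self V) := by
  classical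
  intro I c hc
  refine ⟨coproductComparison_injective _ hc, fun f => ?_⟩
  have := preservesColimitsOfShape_incl h (Discrete I)
  let d : Cofan fun _ : I => V := Cofan.mk c.pt.obj fun i => (c.inj i).hom
  have hd : IsColimit d := isColimitCofanMkObjOfIsColimit (Subgen.incl V) _ _ hc
  obtain ⟨x, hx⟩ := coproductComparison_surjective V hd f.hom
  have key : ∀ x : ⨁ _ : I, (V ⟶ V), ∃ y : ⨁ _ : I, (Subgen.self V ⟶ Subgen.self V),
      (coproductComparison (Subgen.self V) c y).hom = coproductComparison V d x := by
    intro x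
    induction x using DirectSum.induction_on with
    | zero => exact ⟨0, by rw [map_zero, map_zero]; rfl⟩
    | of i f =>
      refine ⟨DirectSum.of (fun _ => Subgen.self V ⟶ Subgen.self V) i (ObjectProperty.homMk f), ?_⟩
      rw [coproductComparison_of, coproductComparison_of]
      rfl
    | add x y hx hy =>
      obtain ⟨x', hx⟩ := hx
      obtain ⟨y', hy⟩ := hy
      exact ⟨x' + y', by rw [map_add, map_add, ← hx, ← hy]; rfl⟩
  obtain ⟨y, hy⟩ := key x
  exact ⟨y, by ext : 1; rw [hy, hx]⟩

lemma IsWeakTilting.isClassicalOneTilting_subgenSelf (h : IsWeakTilting V) [Module.Finite R V] :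
    IsClassicalOneTilting (Subgen.self V) :=
  ⟨h.gen_subgenSelf_eq, isSelfSmall_subgenSelf h.gen_le_kerExt_one⟩

lemma IsWeakTilting.subgenSelf (h : IsWeakTilting V) : IsWeakTilting (Subgen.self V) :=
  have := isGrothendieckAbelian_subgen h.gen_le_kerExt_one
  isWeakTilting_of_gen_eq h.gen_subgenSelf_eq

end SubgenTilting

/-! ### The functor between hearts induced by an exact fully faithful functor -/

section HeartFunctor

universe w' u'

lemma eq_zero_of_comp_mor₁_eq_zero {C : Type u} [Category.{v} C] [Abelian C]
    [HasDerivedCategory.{w} C] {W X Y Z : DerivedCategory C} {f : X ⟶ Y} {g : Y ⟶ Z}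
    {δ : Z ⟶ X⟦(1 : ℤ)⟧} (hT : Triangle.mk f g δ ∈ distTriang _)
    (hW : ∀ m : W⟦(1 : ℤ)⟧ ⟶ Z, m = 0) (l : W ⟶ X) (hl : l ≫ f = 0) : l = 0 := by
  obtain ⟨m, hm⟩ := exists_lift_of_triangle (rotate_triangle (rotate_triangle hT)) (l⟦(1 : ℤ)⟧')
    (by rw [Preadditive.comp_neg, ← Functor.map_comp, hl, Functor.map_zero, neg_zero])
  apply (shiftFunctor (DerivedCategory C) (1 : ℤ)).map_injective
  rw [hm, hW m, zero_comp, Functor.map_zero]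

/-- The homology in degree `-1` of the cone of a morphism between stalk complexes is its kernel. -/
lemma exists_mono_homology_of_stalk {C : Type u} [Category.{v} C] [Abelian C]
    [HasDerivedCategory.{w} C] {M N : C} {a : M ⟶ N} {X : DerivedCategory C}
    {p : (singleFunctor C 0).obj N ⟶ X} {δ : X ⟶ ((singleFunctor C 0).obj M)⟦(1 : ℤ)⟧}
    (hT : Triangle.mk ((singleFunctor C 0).map a) p δ ∈ distTriang _) :
    ∃ (i : (homologyFunctor C (-1)).obj X ⟶ M) (w : i ≫ a = 0),
      Mono i ∧ (ShortComplex.mk i a w).Exact := by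
  obtain ⟨d, w, _, hd⟩ := exists_mono_homology₃ hT (-1) 0 rfl
    (isZero_homology_stalk 0 (-1) (by simp) N)
  have hnat : (homologyFunctor C 0).map ((singleFunctor C 0).map a) ≫ (homologyStalkIso 0 N).hom =
      (homologyStalkIso 0 M).hom ≫ a :=
    (singleFunctorCompHomologyFunctorIso C 0).hom.naturality a
  have hw : (d ≫ (homologyStalkIso 0 M).hom) ≫ a = 0 := by
    rw [Category.assoc, ← hnat, ← Category.assoc, w, zero_comp]
  refine ⟨d ≫ (homologyStalkIso 0 M).hom, hw, mono_comp _ _, ?_⟩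
  exact (ShortComplex.exact_iff_of_iso (S₁ := ShortComplex.mk _ _ w)
    (S₂ := ShortComplex.mk _ _ hw) (ShortComplex.isoMk (Iso.refl _) (homologyStalkIso 0 M)
      (homologyStalkIso 0 N) (by simp) hnat.symm)).1 hd

variable {C : Type u} [Category.{v} C] [Abelian C] [HasDerivedCategory.{w} C]
  {D : Type u'} [Category.{v} D] [Abelian D] [HasDerivedCategory.{w'} D]
  (E : C ⥤ D) [E.Additive] [PreservesFiniteLimits E] [PreservesFiniteColimits E]

lemma map_triangle {X Y Z : DerivedCategory C} {f : X ⟶ Y} {g : Y ⟶ Z} {δ : Z ⟶ X⟦(1 : ℤ)⟧}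
    (hT : Triangle.mk f g δ ∈ distTriang _) :
    Triangle.mk (E.mapDerivedCategory.map f) (E.mapDerivedCategory.map g)
      (E.mapDerivedCategory.map δ ≫ (E.mapDerivedCategory.commShiftIso (1 : ℤ)).hom.app X) ∈
        distTriang _ :=
  E.mapDerivedCategory.map_distinguished _ hT

/-- An exact functor commutes with stalk complexes. -/
def mapStalkIso (n : ℤ) (A : C) : E.mapDerivedCategory.obj ((singleFunctor C n).obj A) ≅
    (singleFunctor D n).obj (E.obj A) :=
  (E.mapDerivedCategorySingleFunctor n).app A

lemma mapStalkIso_hom_naturality (n : ℤ) {A B : C} (f : A ⟶ B) :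
    E.mapDerivedCategory.map ((singleFunctor C n).map f) ≫ (mapStalkIso E n B).hom =
      (mapStalkIso E n A).hom ≫ (singleFunctor D n).map (E.map f) :=
  (E.mapDerivedCategorySingleFunctor n).hom.naturality f

lemma mapStalkIso_inv_naturality (n : ℤ) {A B : C} (f : A ⟶ B) :
    (mapStalkIso E n A).inv ≫ E.mapDerivedCategory.map ((singleFunctor C n).map f) =
      (singleFunctor D n).map (E.map f) ≫ (mapStalkIso E n B).inv :=
  ((E.mapDerivedCategorySingleFunctor n).inv.naturality f).symm

section

variable [E.Full] [E.Faithful]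

omit [E.Full] in
lemma map_stalk_injective (A B : C) :
    Function.Injective (E.mapDerivedCategory.map :
      ((singleFunctor C 0).obj A ⟶ (singleFunctor C 0).obj B) → _) := by
  intro f g hfg
  obtain ⟨f, rfl⟩ := (singleFunctor C 0).map_surjective f
  obtain ⟨g, rfl⟩ := (singleFunctor C 0).map_surjective g
  congr 1
  apply E.map_injective
  apply (singleFunctor D 0).map_injective
  rw [← cancel_epi (mapStalkIso E 0 A).hom, ← mapStalkIso_hom_naturality, hfg,
    mapStalkIso_hom_naturality]

omit [E.Faithful] in
lemma map_stalk_surjective (A B : C) :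
    Function.Surjective (E.mapDerivedCategory.map :
      ((singleFunctor C 0).obj A ⟶ (singleFunctor C 0).obj B) → _) := by
  intro f
  obtain ⟨g, hg⟩ := (singleFunctor D 0).map_surjective
    ((mapStalkIso E 0 A).inv ≫ f ≫ (mapStalkIso E 0 B).hom)
  obtain ⟨g, rfl⟩ := E.map_surjective g
  refine ⟨(singleFunctor C 0).map g, ?_⟩
  rw [← cancel_mono (mapStalkIso E 0 B).hom, mapStalkIso_hom_naturality, hg]
  simp

end

variable {T₁ F₁ : ObjectProperty C} {T₂ F₂ : ObjectProperty D} {V : C}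
  (h₁ : IsTiltingTorsionPair T₁ F₁ V) (h₂ : IsTiltingTorsionPair T₂ F₂ (E.obj V))
  (hT : ∀ X, T₁ X → T₂ (E.obj X)) (hF : ∀ X, F₁ X → F₂ (E.obj X))

section

variable [E.Full] [E.Faithful]
include h₁ h₂ hT

/-- With `B` embedded in a torsion object `A`, vanishing of `Hom(V[0], A[1])` on both sides presents
`Hom(V[0], B[1])` as the cokernel of `Hom(V, A) → Hom(V, A/B)`, on which `E` is bijective. -/
lemma map_stalk_shift_bijective {B : C} (hB : F₁ B) :
    Function.Bijective (E.mapDerivedCategory.map :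
      ((singleFunctor C 0).obj V ⟶ (singleFunctor C (-1)).obj B) → _) := by
  obtain ⟨A, hA, i, _⟩ := h₁.embeds B hB
  have hS : (ShortComplex.mk i (cokernel.π i) (by simp)).ShortExact :=
    { exact := ShortComplex.exact_cokernel i }
  obtain ⟨δ, ε, hX⟩ := exists_triangle_of_shortExact hS
  constructor
  · refine (injective_iff_map_eq_zero (E.mapDerivedCategory.mapAddHom
      (X := (singleFunctor C 0).obj V) (Y := (singleFunctor C (-1)).obj B))).2 fun f hf => ?_
    obtain ⟨k, rfl⟩ := exists_lift_of_triangle₃ hX f (by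
      rw [← cancel_mono (stalkShiftIso 0 (-1) (by simp) A).hom, zero_comp]
      exact h₁.hom_shift_one A hA _)
    obtain ⟨m, hm⟩ := exists_lift_of_triangle (map_triangle E hX) (E.mapDerivedCategory.map k)
      (by rw [← Functor.map_comp]; exact hf)
    obtain ⟨m, rfl⟩ := map_stalk_surjective E _ _ m
    rw [← Functor.map_comp] at hm
    rw [map_stalk_injective E _ _ hm, Category.assoc, triangle_comp₁₂ hX, comp_zero]
  · intro g
    obtain ⟨k, rfl⟩ := exists_lift_of_triangle₃ (map_triangle E hX) g (by
      let e : (E.mapDerivedCategory.obj ((singleFunctor C 0).obj A))⟦(1 : ℤ)⟧ ≅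
          (singleFunctor D (-1)).obj (E.obj A) :=
        (shiftFunctor _ (1 : ℤ)).mapIso (mapStalkIso E 0 A) ≪≫ stalkShiftIso 0 (-1) (by simp) _
      rw [← cancel_mono e.hom, zero_comp, ← cancel_epi (mapStalkIso E 0 V).inv, comp_zero]
      exact h₂.hom_shift_one _ (hT A hA) _)
    obtain ⟨k, rfl⟩ := map_stalk_surjective E _ _ k
    exact ⟨k ≫ δ, Functor.map_comp _ _ _⟩

end

variable [T₁.IsClosedUnderIsomorphisms] [F₁.IsClosedUnderIsomorphisms]
  [T₂.IsClosedUnderIsomorphisms] [F₂.IsClosedUnderIsomorphisms]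

include h₂ hT hF in
lemma heart_map {X : DerivedCategory C} (hX : heart T₁ F₁ X) :
    heart T₂ F₂ (E.mapDerivedCategory.obj X) := by
  obtain ⟨B, A, hB, hA, i, p, δ, hX⟩ := exists_heart_triangle hX
  exact h₂.torsionPair.heart_of_triangle₂ (map_triangle E hX)
    ((heart T₂ F₂).prop_of_iso (mapStalkIso E (-1) B).symm
      (h₂.torsionPair.heart_stalk_shift (hF B hB)))
    ((heart T₂ F₂).prop_of_iso (mapStalkIso E 0 A).symm (h₂.torsionPair.heart_stalk (hT A hA)))

variable [E.Full] [E.Faithful]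

include h₁ h₂ hT

/-- A five-lemma argument along the triangle `B[1] → Y → A[0]`; the outer terms are controlled by
`Hom(V[1], A[0]) = 0` in the target and by `Hom(V[0], B[2]) = 0` in the source. -/
lemma map_self_bijective {Y : DerivedCategory C} (hY : heart T₁ F₁ Y) :
    Function.Bijective (E.mapDerivedCategory.map : ((singleFunctor C 0).obj V ⟶ Y) → _) := by
  obtain ⟨B, A, hB, hA, i, p, δ, hY⟩ := exists_heart_triangle hY
  have hbij := map_stalk_shift_bijective E h₁ h₂ hT hB
  constructor
  · refine (injective_iff_map_eq_zero (E.mapDerivedCategory.mapAddHom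
      (X := (singleFunctor C 0).obj V) (Y := Y))).2 fun f hf => ?_
    change E.mapDerivedCategory.map f = 0 at hf
    obtain ⟨l, rfl⟩ := exists_lift_of_triangle hY f (map_stalk_injective E _ _ (by
      rw [Functor.map_comp, hf, zero_comp, Functor.map_zero]))
    have hl : E.mapDerivedCategory.map l = 0 := by
      refine eq_zero_of_comp_mor₁_eq_zero (map_triangle E hY) (fun m => ?_) _
        (by rw [← Functor.map_comp, hf])
      have hV := h₂.torsionPair.heart_stalk h₂.self
      exact h₂.torsionPair.hom_eq_zero_of_shiftedAisle
        (shiftedAisle_shift ((aisle T₂).prop_of_iso (mapStalkIso E 0 V).symm hV.1))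
        ((coaisle F₂).prop_of_iso (mapStalkIso E 0 A).symm
          (h₂.torsionPair.heart_stalk (hT A hA)).2) m
    rw [hbij.1 (hl.trans (Functor.map_zero _ _ _).symm), zero_comp]
  · intro g
    obtain ⟨q, hq⟩ := map_stalk_surjective E _ _ (g ≫ E.mapDerivedCategory.map p)
    obtain ⟨k, rfl⟩ := h₁.exists_lift_stalk hB hY q
    obtain ⟨l, hl⟩ := exists_lift_of_triangle (map_triangle E hY) (g - E.mapDerivedCategory.map k)
      (by rw [Preadditive.sub_comp, ← hq, Functor.map_comp, sub_self])
    obtain ⟨l, rfl⟩ := hbij.2 l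
    exact ⟨l ≫ i + k, by rw [Functor.map_add, Functor.map_comp, ← hl, sub_add_cancel]⟩

variable [EnoughInjectives C]

lemma map_heart_injective {X Y : DerivedCategory C} (hX : heart T₁ F₁ X) (hY : heart T₁ F₁ Y) :
    Function.Injective (E.mapDerivedCategory.map : (X ⟶ Y) → _) := by
  refine (injective_iff_map_eq_zero (E.mapDerivedCategory.mapAddHom (X := X) (Y := Y))).2
    fun f hf => ?_
  change E.mapDerivedCategory.map f = 0 at hf
  refine h₁.hom_eq_zero hX hY.2 f fun g => (map_self_bijective E h₁ h₂ hT hY).1 ?_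
  rw [Functor.map_comp, hf, comp_zero, Functor.map_zero]

include hF

variable [EnoughInjectives D] [∀ I : Type v, PreservesColimitsOfShape (Discrete I) E]

lemma map_coproduct_surjective {I : Type v} {c : Cofan fun _ : I => V} (hc : IsColimit c)
    {Y : DerivedCategory C} (hY : heart T₁ F₁ Y) :
    Function.Surjective (E.mapDerivedCategory.map :
      ((singleFunctor C 0).obj c.pt ⟶ Y) → _) := by
  intro g
  have := hY.2.1
  have := (heart_map E h₂ hT hF hY).2.1
  choose f hf using fun i => (map_self_bijective E h₁ h₂ hT hY).2
    (E.mapDerivedCategory.map ((singleFunctor C 0).map (c.inj i)) ≫ g)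
  obtain ⟨k, hk⟩ := exists_stalk_coproduct_desc hc (-1) f
  refine ⟨k, ?_⟩
  let d : Cofan fun _ : I => E.obj V := Cofan.mk (E.obj c.pt) fun i => E.map (c.inj i)
  have hd : IsColimit d := isColimitCofanMkObjOfIsColimit E _ _ hc
  rw [← cancel_epi (mapStalkIso E 0 c.pt).inv]
  refine stalk_coproduct_hom_ext hd (-1) fun i => ?_
  change (singleFunctor D 0).map (E.map (c.inj i)) ≫ _ =
    (singleFunctor D 0).map (E.map (c.inj i)) ≫ _
  rw [← Category.assoc, ← Category.assoc, ← mapStalkIso_inv_naturality, Category.assoc,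
    Category.assoc, ← hf, ← hk i, Functor.map_comp]

variable [HasCoproducts.{v} C]

lemma map_heart_surjective {X Y : DerivedCategory C} (hX : heart T₁ F₁ X) (hY : heart T₁ F₁ Y) :
    Function.Surjective (E.mapDerivedCategory.map : (X ⟶ Y) → _) := by
  intro g
  obtain ⟨I, c, hc, M, hM, a, p, δ, hX⟩ := h₁.exists_presentation hX
  obtain ⟨k, hk⟩ := map_coproduct_surjective E h₁ h₂ hT hF hc hY (E.mapDerivedCategory.map p ≫ g)
  -- Faithfulness on maps out of `M[0]` shows that `k` kills `a`, so it descends to `X`. The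
  -- descended map has image `g`, because the difference factors through `E(M)[1]`, which has no
  -- maps to the heart.
  obtain ⟨l, rfl⟩ := exists_desc_of_triangle hX k
    (map_heart_injective E h₁ h₂ hT (h₁.torsionPair.heart_stalk hM) hY (by
      rw [Functor.map_comp, hk, ← Category.assoc, ← Functor.map_comp, triangle_comp₁₂ hX,
        Functor.map_zero, zero_comp, Functor.map_zero]))
  refine ⟨l, ?_⟩
  rw [← sub_eq_zero]
  obtain ⟨m, hm⟩ := exists_desc_of_triangle₃ (map_triangle E hX) (E.mapDerivedCategory.map l - g)
    (by rw [Preadditive.comp_sub, ← Functor.map_comp, hk, sub_self])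
  rw [hm, h₂.torsionPair.hom_eq_zero_of_shiftedAisle (shiftedAisle_shift
    ((aisle T₂).prop_of_iso (mapStalkIso E 0 M).symm (aisle_stalk (hT M hM))))
    (heart_map E h₂ hT hF hY).2 m, comp_zero]

omit h₁ hT hF [F₁.IsClosedUnderIsomorphisms] [E.Faithful] [EnoughInjectives C]
  [∀ I : Type v, PreservesColimitsOfShape (Discrete I) E] [HasCoproducts.{v} C] in
-- `Y` is the cone of a map between torsion objects, and that map comes from `C`. The cone `X`
-- formed in `C` lies in the heart: `H^0(X)` is a quotient of a torsion object, and `E` carries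
-- `H^{-1}(X)`, a kernel, into the torsion-free `H^{-1}(Y)`.
lemma exists_heart_map_iso [HasCoproducts.{v} D] (h₁ : IsTorsionPair T₁ F₁)
    (hess : ∀ Y, T₂ Y → ∃ X, T₁ X ∧ Nonempty (E.obj X ≅ Y))
    (hF' : ∀ X, F₂ (E.obj X) → F₁ X) {Y : DerivedCategory D} (hY : heart T₂ F₂ Y) :
    ∃ X, heart T₁ F₁ X ∧ Nonempty (E.mapDerivedCategory.obj X ≅ Y) := by
  obtain ⟨I, c, hc, M, hM, a, p, δ, hT⟩ := h₂.exists_presentation hY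
  obtain ⟨N, hN, ⟨e⟩⟩ := hess c.pt (h₂.torsionPair.torsion_coproduct hc fun _ => h₂.self)
  obtain ⟨M', hM', ⟨e'⟩⟩ := hess M hM
  obtain ⟨b, hb⟩ := E.map_surjective (e'.hom ≫ a ≫ e.inv)
  obtain ⟨X, q, ε, hX⟩ := distinguished_cocone_triangle ((singleFunctor C 0).map b)
  have hT' := distinguished_of_iso hT ((singleFunctor D 0).mapIso e')
    ((singleFunctor D 0).mapIso e) (Iso.refl _) (f' := (singleFunctor D 0).map (E.map b))
    (by rw [hb]; simp) rfl
  obtain ⟨i, w, _, hi⟩ := exists_mono_homology_of_stalk hX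
  obtain ⟨i', w', _, hi'⟩ := exists_mono_homology_of_stalk hT'
  have hXF : F₁ ((homologyFunctor C (-1)).obj X) := by
    apply hF'
    obtain ⟨l, hl⟩ := hi'.lift' (E.map i) (by
      change E.map i ≫ E.map b = 0
      rw [← Functor.map_comp, w, Functor.map_zero])
    have : Mono (l ≫ i') := hl ▸ inferInstanceAs (Mono (E.map i))
    have := mono_of_mono l i'
    exact h₂.torsionPair.torsionFree_of_mono l hY.2.2
  have : ((singleFunctor C 0).obj M').IsLE (0 + 1) := TStructure.t.isLE_of_le _ 0 _
  have : ((singleFunctor C 0).obj N).IsGE (-1) := TStructure.t.isGE_of_ge _ _ 0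
  have : Epi ((homologyFunctor C 0).map q) := epi_homology_map₂ hX 0 1 rfl
    (isZero_homology_stalk 0 1 (by simp) M')
  refine ⟨X, ⟨⟨isLE_of_triangle₃ hX 0 _ rfl, h₁.torsion_of_epi ((homologyFunctor C 0).map q)
    (T₁.prop_of_iso (homologyStalkIso 0 N).symm hN)⟩, isGE_of_triangle₃ hX (-1) 0 rfl, hXF⟩, ?_⟩
  exact ⟨Triangle.π₃.mapIso (isoTriangleOfIso₁₂ _ _ (map_triangle E hX) hT' (mapStalkIso E 0 M')
    (mapStalkIso E 0 N) (mapStalkIso_hom_naturality E 0 b))⟩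

end HeartFunctor

/-! ### The equivalence of hearts -/

section SubgenEquivalence

variable {R : Type u} [Ring R] {V : ModuleCat.{u} R}

lemma IsWeakTilting.kerHom_le_subgen (h : IsWeakTilting V) : kerHom V ≤ subgen V := h.embeds

lemma IsWeakTilting.isTorsionPair_subgen (h : IsWeakTilting V) :
    IsTorsionPair (torsionIn V) (torsionFreeIn V) := by
  have := hasColimitsOfSize_subgen h.gen_le_kerExt_one
  rw [torsionIn_eq h.gen_le_kerExt_one h.pres_eq_gen, torsionFreeIn_eq]
  exact isTorsionPair_gen h.subgenSelf.gen_le_kerExt_one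

variable [HasDerivedCategory.{w} (ModuleCat.{u} R)] [HasDerivedCategory.{t} (Subgen V)]

theorem IsWeakTilting.exists_isEquivalence (h : IsWeakTilting V) :
    ∃ h : ∀ X : DerivedCategory (Subgen V), heart (torsionIn V) (torsionFreeIn V) X →
        heart (pres V) (kerHom V) ((Subgen.incl V).mapDerivedCategory.obj X),
      (ObjectProperty.lift (heart (pres V) (kerHom V))
        ((heart (torsionIn V) (torsionFreeIn V)).ι ⋙ (Subgen.incl V).mapDerivedCategory)
        (fun X => h X.obj X.property)).IsEquivalence := by
  have hV := h.gen_le_kerExt_one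
  have := hasColimitsOfSize_subgen hV
  have := isGrothendieckAbelian_subgen hV
  have := fun I : Type u => preservesColimitsOfShape_incl hV (Discrete I)
  rw [torsionIn_eq hV h.pres_eq_gen, torsionFreeIn_eq, h.pres_eq_gen]
  have h₁ : IsTiltingTorsionPair (gen (Subgen.self V)) (kerHom (Subgen.self V)) (Subgen.self V) :=
    h.subgenSelf.isTiltingTorsionPair
  have h₂ : IsTiltingTorsionPair (gen V) (kerHom V) ((Subgen.incl V).obj (Subgen.self V)) :=
    h.isTiltingTorsionPair
  have hT := fun X => (gen_subgenSelf_iff hV X).1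
  have hF := fun X : Subgen V => (kerHom_subgenSelf_iff X).1
  refine ⟨fun X hX => heart_map _ h₂ hT hF hX, ?_⟩
  refine { faithful := ⟨fun {X Y f g} hfg => ?_⟩, full := ⟨fun {X Y} f => ?_⟩,
           essSurj := ⟨fun Y => ?_⟩ }
  · ext : 1
    exact map_heart_injective _ h₁ h₂ hT X.property Y.property
      (congr_arg (fun l => l.hom) hfg)
  · obtain ⟨g, hg⟩ := map_heart_surjective _ h₁ h₂ hT hF X.property Y.property f.hom
    exact ⟨ObjectProperty.homMk g, by ext : 1; exact hg⟩
  · obtain ⟨X, hX, ⟨e⟩⟩ := exists_heart_map_iso (Subgen.incl V) h₂ h₁.torsionPair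
      (fun Y hY => ⟨⟨Y, gen_le_subgen _ hY⟩, (gen_subgenSelf_iff hV _).2 hY, ⟨Iso.refl _⟩⟩)
      (fun X => (kerHom_subgenSelf_iff X).2) Y.property
    exact ⟨⟨X, hX⟩, ⟨ObjectProperty.isoMk _ e⟩⟩

end SubgenEquivalence

end TiltingHeart

end

theorem mainTheorem6 {R : Type u} [Ring R] (V : ModuleCat.{u} R)
    [HasDerivedCategory.{w} (ModuleCat.{u} R)]
    [HasDerivedCategory.{t} (TiltingHeart.Subgen V)] :
    (TiltingHeart.IsClassicalOneTilting V → TiltingHeart.StalkIsProgenerator V) ∧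
    (TiltingHeart.StalkIsProgenerator V ↔ TiltingHeart.IsStalkProgeneratorModule V) ∧
    (TiltingHeart.StalkIsProgenerator V ∨ TiltingHeart.IsStalkProgeneratorModule V →
      IsGrothendieckAbelian.{u} (TiltingHeart.Subgen V) ∧
      TiltingHeart.pres V ≤ TiltingHeart.subgen V ∧
      TiltingHeart.kerHom V ≤ TiltingHeart.subgen V ∧
      TiltingHeart.IsTorsionPair (TiltingHeart.torsionIn V) (TiltingHeart.torsionFreeIn V) ∧
      TiltingHeart.IsClassicalOneTilting (TiltingHeart.Subgen.self V) ∧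
      ∃ h : ∀ X : DerivedCategory (TiltingHeart.Subgen V),
          TiltingHeart.heart (TiltingHeart.torsionIn V) (TiltingHeart.torsionFreeIn V) X →
          TiltingHeart.heart (TiltingHeart.pres V) (TiltingHeart.kerHom V)
            ((TiltingHeart.Subgen.incl V).mapDerivedCategory.obj X),
        (ObjectProperty.lift
          (TiltingHeart.heart (TiltingHeart.pres V) (TiltingHeart.kerHom V))
          ((TiltingHeart.heart (TiltingHeart.torsionIn V) (TiltingHeart.torsionFreeIn V)).ι ⋙
            (TiltingHeart.Subgen.incl V).mapDerivedCategory)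
          (fun X => h X.obj X.property)).IsEquivalence) := by
  refine ⟨fun h => h.stalkIsProgenerator,
    ⟨fun h => h.isStalkProgeneratorModule, fun h => h.stalkIsProgenerator⟩, fun h => ?_⟩
  have h' : TiltingHeart.IsStalkProgeneratorModule V :=
    h.elim (fun h => h.isStalkProgeneratorModule) id
  have hW := h'.isWeakTilting
  have := h'.finitePresentation
  exact ⟨TiltingHeart.isGrothendieckAbelian_subgen hW.gen_le_kerExt_one,
    fun X hX => TiltingHeart.gen_le_subgen X (TiltingHeart.pres_le_gen X hX),
    hW.kerHom_le_subgen, hW.isTorsionPair_subgen, hW.isClassicalOneTilting_subgenSelf,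
    hW.exists_isEquivalence⟩
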